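/- Let $\Omega\subset\mathbb R^N$ be a bounded open set, $T>0$, $Q=\Omega\times(0,T)$. Let $M:Q\to\mathbb R^{N\times N}$ be measurable with $\alpha|\xi|^2\le M(x,t)\xi\cdot\xi\le\beta|\xi|^2$ for a.e. $(x,t)\in Q$ and all $\xi\in\mathbb R^N$, where $\alpha,\beta>0$. Let $h\in W^{1,\infty}_{loc}(\mathbb R)$ (i.e. $h$ is locally Lipschitz) with $h(0)=0$ and $\lim_{|l|\to\infty}|h(l)|/|l|=+\infty$. Let $E\in(L^2(Q))^N$ and $f\in L^2(0,T;W^{-1,2}(\Omega))$. Consider the problem $$\partial_t u-\operatorname{div}(M\nabla u)=-\operatorname{div}(h(u)E)+f\ \text{ in }Q,\qquad u(\cdot,0)=0\ \text{ in }\Omega,\qquad u=0\ \text{ on }\partial\Omega\times(0,T).\tag{P}$$ A function $v\in L^2(0,T;W^{1,2}_0(\Omega))$ is called a subsolution of (P) if $h(v)E\in (L^2(0,T;W^{-1,2}(\Omega)))^N$ (componentwise, as distributions); $\partial_t v\in L^2(0,T;W^{-1,2}(\Omega))+L^1(Q)$, with an initial value $v(\cdot,0)\in L^1(\Omega)$ satisfying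 $v(\cdot,0)\le 0$ a.e. in $\Omega$ (that is, for some $G\in L^2(0,T;W^{-1,2}(\Omega))$, $g\in L^1(Q)$ and $v(\cdot,0)\in L^1(\Omega)$ one has $-\int_Q v\,\partial_t\psi\,dx\,dt-\int_\Omega v(x,0)\psi(x,0)\,dx=\int_0^T\langle G,\psi\rangle\,dt+\int_Q g\psi\,dx\,dt$ for all $\psi\in C_c^\infty(\Omega\times(-\infty,T))$); and, for every $0\le\phi\in L^2(0,T;W^{1,2}_0(\Omega))\cap L^\infty(Q)$, the functions $M\nabla v\cdot\nabla\phi$ and $h(v)E\cdot\nabla\phi$ are integrable on $Q$ and $$\int_0^T\!\!\int_\Omega \partial_t v\,\phi\,dx\,dt+\int_0^T\!\!\int_\Omega M\nabla v\cdot\nabla\phi\,dx\,dt\le\int_0^T\!\!\int_\Omega h(v)E\cdot\nabla\phi\,dx\,dt+\int_0^T\!\!\int_\Omega f\phi\,dx\,dt ,$$ where the first integral means $\int_0^T\langle G,\phi\rangle\,dt+\int_Q g\phi\,dx\,dt$ and the last one means $\int_0^T\langle f,\phi\rangle\,dt$. A supersolution $w$ is defined in the same way with $w(\cdot,0)\ge0$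 and the reversed inequality $\ge$. Let $v$ be a subsolution and $w$ a supersolution of (P). 1. If $v,w\in L^\infty(Q)$, then $v\le w$ a.e. in $Q$. 2. If, for some $\theta>0$ and some constant $c$, $|h'(l)|\le c(|l|^\theta+1)$ for a.e. $l\in\mathbb R$ and $(|v|^{2\theta}+|w|^{2\theta})|E|^2\in L^1(Q)$, then $v\le w$ a.e. in $Q$ (no boundedness of $v,w$ is assumed). -/

import Mathlib

open MeasureTheory Filter Topology Set
open scoped ENNReal NNReal ContDiff Matrix Gradient

noncomputable section

namespace ParabolicComparison

/-- The Euclidean space `ℝ^N`. -/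
abbrev Sp (N : ℕ) : Type := EuclideanSpace ℝ (Fin N)

/-- Lebesgue measure on `Ω`. -/
abbrev vol {N : ℕ} (Ω : Set (Sp N)) : Measure (Sp N) := volume.restrict Ω

/-- The cylinder `Q = Ω × (0,T)`. -/
def cylinder {N : ℕ} (Ω : Set (Sp N)) (T : ℝ) : Set (Sp N × ℝ) := Ω ×ˢ Ioo 0 T

/-- `ψ ∈ C_c^∞(U)`. -/
def IsTestFunction {X : Type*} [NormedAddCommGroup X] [NormedSpace ℝ X]
    (U : Set X) (ψ : X → ℝ) : Prop :=
  ContDiff ℝ ∞ ψ ∧ HasCompactSupport ψ ∧ tsupport ψ ⊆ U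

/-- The space `W_0^{1,2}(Ω)`: the closure of `C_c^∞(Ω)` in the norm
`(‖u‖₂² + ‖∇u‖₂²)^{1/2}`. An element is kept as the pair `(u, ∇u)`. -/
def W012 {N : ℕ} (Ω : Set (Sp N)) :
    Submodule ℝ (WithLp 2 (Lp ℝ 2 (vol Ω) × Lp (Sp N) 2 (vol Ω))) :=
  (Submodule.span ℝ {p | ∃ ζ : Sp N → ℝ, IsTestFunction Ω ζ ∧
    (p.fst : Sp N → ℝ) =ᵐ[vol Ω] ζ ∧ (p.snd : Sp N → Sp N) =ᵐ[vol Ω] ∇ ζ}).topologicalClosure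

/-- The space `W^{-1,2}(Ω)`: the dual of `W_0^{1,2}(Ω)`. -/
abbrev Wm12 {N : ℕ} (Ω : Set (Sp N)) : Type := StrongDual ℝ (W012 Ω)

/-- The element `p` of `W_0^{1,2}(Ω)` is the class of the function `u`, with weak gradient `Du`. -/
def Represents {N : ℕ} (Ω : Set (Sp N)) (p : W012 Ω) (u : Sp N → ℝ) (Du : Sp N → Sp N) : Prop :=
  (p.1.fst : Sp N → ℝ) =ᵐ[vol Ω] u ∧ (p.1.snd : Sp N → Sp N) =ᵐ[vol Ω] Du

open Classical in
/-- The (unique) element of `W_0^{1,2}(Ω)` given by `u` with weak gradient `Du`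
(`0` if there is none). -/
def toW012 {N : ℕ} (Ω : Set (Sp N)) (u : Sp N → ℝ) (Du : Sp N → Sp N) : W012 Ω :=
  if hp : ∃ p : W012 Ω, Represents Ω p u Du then hp.choose else 0

/-- `u ∈ L²(0,T; W_0^{1,2}(Ω))`, with weak spatial gradient `Du`: a function on `Q` with
`u, Du ∈ L²(Q)` and `u(·,t) ∈ W_0^{1,2}(Ω)`, `∇(u(·,t)) = Du(·,t)` for a.e. `t ∈ (0,T)`. -/
def MemL2W012 {N : ℕ} (Ω : Set (Sp N)) (T : ℝ) (u : Sp N × ℝ → ℝ) (Du : Sp N × ℝ → Sp N) : Prop :=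
  MemLp u 2 (volume.restrict (cylinder Ω T)) ∧ MemLp Du 2 (volume.restrict (cylinder Ω T)) ∧
    ∀ᵐ t ∂(volume.restrict (Ioo 0 T)),
      ∃ p : W012 Ω, Represents Ω p (fun x => u (x, t)) (fun x => Du (x, t))

/-- `F ∈ L²(0,T; W^{-1,2}(Ω))` (Bochner space). -/
def MemL2Wm12 {N : ℕ} (Ω : Set (Sp N)) (T : ℝ) (F : ℝ → Wm12 Ω) : Prop :=
  MemLp F 2 (volume.restrict (Ioo 0 T))

/-- The duality `∫_0^T ⟨F(t), φ(·,t)⟩ dt` between `L²(0,T; W^{-1,2}(Ω))` and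
`L²(0,T; W_0^{1,2}(Ω))`; `Dφ` is the spatial gradient of `φ`. -/
def duality {N : ℕ} (Ω : Set (Sp N)) (T : ℝ) (F : ℝ → Wm12 Ω)
    (φ : Sp N × ℝ → ℝ) (Dφ : Sp N × ℝ → Sp N) : ℝ :=
  ∫ t in Ioo 0 T, F t (toW012 Ω (fun x => φ (x, t)) (fun x => Dφ (x, t)))

/-- The classical spatial gradient of a function of `(x,t)`. -/
def spaceGrad {N : ℕ} (ψ : Sp N × ℝ → ℝ) (p : Sp N × ℝ) : Sp N := ∇ (fun y => ψ (y, p.2)) p.1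

/-- The classical time derivative of a function of `(x,t)`. -/
def timeDeriv {N : ℕ} (ψ : Sp N × ℝ → ℝ) (p : Sp N × ℝ) : ℝ := deriv (fun s => ψ (p.1, s)) p.2

/-- A function `k` on `Q`, regarded as a distribution, belongs to `L²(0,T; W^{-1,2}(Ω))`. -/
def FunMemL2Wm12 {N : ℕ} (Ω : Set (Sp N)) (T : ℝ) (k : Sp N × ℝ → ℝ) : Prop :=
  ∃ F : ℝ → Wm12 Ω, MemL2Wm12 Ω T F ∧ ∀ ψ : Sp N × ℝ → ℝ, IsTestFunction (cylinder Ω T) ψ →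
    IntegrableOn (fun p => k p * ψ p) (cylinder Ω T) ∧
    ∫ p in cylinder Ω T, k p * ψ p = duality Ω T F ψ (spaceGrad ψ)

/-- `∂v/∂t = G + g` in the sense of distributions on `Q`, with initial value `v(·,0) = v₀`:
the test functions range over `C_c^∞(Ω × (-∞,T))`, so they need not vanish at `t = 0`. -/
def HasTimeDerivative {N : ℕ} (Ω : Set (Sp N)) (T : ℝ) (v : Sp N × ℝ → ℝ)
    (G : ℝ → Wm12 Ω) (g : Sp N × ℝ → ℝ) (v₀ : Sp N → ℝ) : Prop :=
  ∀ ψ : Sp N × ℝ → ℝ, IsTestFunction (Ω ×ˢ Iio T) ψ →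
    -(∫ p in cylinder Ω T, v p * timeDeriv ψ p) - ∫ x in Ω, v₀ x * ψ (x, 0) =
      duality Ω T G ψ (spaceGrad ψ) + ∫ p in cylinder Ω T, g p * ψ p

/-- `A ξ · η`. -/
def matForm {N : ℕ} (A : Matrix (Fin N) (Fin N) ℝ) (ξ η : Sp N) : ℝ :=
  (A *ᵥ ξ.ofLp) ⬝ᵥ η.ofLp

/-- `α |ξ|² ≤ M(x,t) ξ · ξ ≤ β |ξ|²` for a.e. `(x,t) ∈ Q` and all `ξ`, with `M` measurable. -/
def IsElliptic {N : ℕ} (Ω : Set (Sp N)) (T α β : ℝ)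
    (M : Sp N × ℝ → Matrix (Fin N) (Fin N) ℝ) : Prop :=
  (∀ i j, AEMeasurable (fun p => M p i j) (volume.restrict (cylinder Ω T))) ∧
  ∀ᵐ p ∂(volume.restrict (cylinder Ω T)), ∀ ξ : Sp N,
    α * ‖ξ‖ ^ 2 ≤ matForm (M p) ξ ξ ∧ matForm (M p) ξ ξ ≤ β * ‖ξ‖ ^ 2

/-- `h ∈ W^{1,∞}_loc(ℝ)` (its continuous representative), `h(0) = 0`, and
`|h(l)|/|l| → ∞` as `|l| → ∞`. -/
def IsSuperlinear (h : ℝ → ℝ) : Prop :=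
  LocallyLipschitz h ∧ h 0 = 0 ∧ Tendsto (fun l => |h l| / |l|) (cocompact ℝ) atTop

/-- `0 ≤ φ ∈ L²(0,T; W_0^{1,2}(Ω)) ∩ L^∞(Q)`, with spatial gradient `Dφ`. -/
def IsNonnegTest {N : ℕ} (Ω : Set (Sp N)) (T : ℝ)
    (φ : Sp N × ℝ → ℝ) (Dφ : Sp N × ℝ → Sp N) : Prop :=
  MemL2W012 Ω T φ Dφ ∧ MemLp φ ∞ (volume.restrict (cylinder Ω T)) ∧
    ∀ᵐ p ∂(volume.restrict (cylinder Ω T)), 0 ≤ φ p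

/-- What sub- and supersolutions have in common: `v ∈ L²(0,T; W_0^{1,2}(Ω))` with gradient `Dv`,
`h(v) E ∈ (L²(0,T; W^{-1,2}(Ω)))^N`, `∂v/∂t = G + g ∈ L²(0,T; W^{-1,2}(Ω)) + L¹(Q)` with
`v(·,0) = v₀ ∈ L¹(Ω)`, and the integrals of `M ∇v · ∇φ` and `h(v) E · ∇φ` exist for
all test functions `φ`. -/
structure IsCandidate {N : ℕ} (Ω : Set (Sp N)) (T : ℝ)
    (M : Sp N × ℝ → Matrix (Fin N) (Fin N) ℝ) (h : ℝ → ℝ) (E : Sp N × ℝ → Sp N)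
    (v : Sp N × ℝ → ℝ) (Dv : Sp N × ℝ → Sp N)
    (G : ℝ → Wm12 Ω) (g : Sp N × ℝ → ℝ) (v₀ : Sp N → ℝ) : Prop where
  mem : MemL2W012 Ω T v Dv
  convection : ∀ i : Fin N, FunMemL2Wm12 Ω T (fun p => h (v p) * E p i)
  memG : MemL2Wm12 Ω T G
  memg : IntegrableOn g (cylinder Ω T)
  mem₀ : IntegrableOn v₀ Ω
  timeDerivative : HasTimeDerivative Ω T v G g v₀
  integrable_diffusion : ∀ φ Dφ, IsNonnegTest Ω T φ Dφ →
    IntegrableOn (fun p => matForm (M p) (Dv p) (Dφ p)) (cylinder Ω T)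
  integrable_convection : ∀ φ Dφ, IsNonnegTest Ω T φ Dφ →
    IntegrableOn (fun p => h (v p) * inner ℝ (E p) (Dφ p)) (cylinder Ω T)

/-- The left side `∫∫ ∂v/∂t φ + ∫∫ M ∇v · ∇φ`, where `∂v/∂t = G + g`. -/
def lhs {N : ℕ} (Ω : Set (Sp N)) (T : ℝ) (M : Sp N × ℝ → Matrix (Fin N) (Fin N) ℝ)
    (Dv : Sp N × ℝ → Sp N) (G : ℝ → Wm12 Ω) (g : Sp N × ℝ → ℝ)
    (φ : Sp N × ℝ → ℝ) (Dφ : Sp N × ℝ → Sp N) : ℝ :=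
  (duality Ω T G φ Dφ + ∫ p in cylinder Ω T, g p * φ p) +
    ∫ p in cylinder Ω T, matForm (M p) (Dv p) (Dφ p)

/-- The right side `∫∫ h(v) E · ∇φ + ∫∫ f φ`. -/
def rhs {N : ℕ} (Ω : Set (Sp N)) (T : ℝ) (h : ℝ → ℝ) (E : Sp N × ℝ → Sp N) (f : ℝ → Wm12 Ω)
    (v : Sp N × ℝ → ℝ) (φ : Sp N × ℝ → ℝ) (Dφ : Sp N × ℝ → Sp N) : ℝ :=
  (∫ p in cylinder Ω T, h (v p) * inner ℝ (E p) (Dφ p)) + duality Ω T f φ Dφ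

/-- `v` is a subsolution of `∂u/∂t - div(M ∇u) = -div(h(u) E) + f` in `Q`, `u(·,0) = 0` in `Ω`,
`u = 0` on `∂Ω × (0,T)`. -/
def IsSubsolution {N : ℕ} (Ω : Set (Sp N)) (T : ℝ)
    (M : Sp N × ℝ → Matrix (Fin N) (Fin N) ℝ) (h : ℝ → ℝ) (E : Sp N × ℝ → Sp N)
    (f : ℝ → Wm12 Ω) (v : Sp N × ℝ → ℝ) : Prop :=
  ∃ Dv G g v₀, IsCandidate Ω T M h E v Dv G g v₀ ∧
    (∀ᵐ x ∂(vol Ω), v₀ x ≤ 0) ∧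
    ∀ φ Dφ, IsNonnegTest Ω T φ Dφ → lhs Ω T M Dv G g φ Dφ ≤ rhs Ω T h E f v φ Dφ

/-- `w` is a supersolution of the same problem. -/
def IsSupersolution {N : ℕ} (Ω : Set (Sp N)) (T : ℝ)
    (M : Sp N × ℝ → Matrix (Fin N) (Fin N) ℝ) (h : ℝ → ℝ) (E : Sp N × ℝ → Sp N)
    (f : ℝ → Wm12 Ω) (w : Sp N × ℝ → ℝ) : Prop :=
  ∃ Dw G g w₀, IsCandidate Ω T M h E w Dw G g w₀ ∧
    (∀ᵐ x ∂(vol Ω), 0 ≤ w₀ x) ∧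
    ∀ φ Dφ, IsNonnegTest Ω T φ Dφ → rhs Ω T h E f w φ Dφ ≤ lhs Ω T M Dw G g φ Dφ

end ParabolicComparison

end

/-! Put `z = v - w`. Each of the two assumptions serves only to produce a weight `ρ ∈ L²(Q)` with
`|h(v) - h(w)| |E| ≤ ρ |z|` (`exists_lipschitz_weight_of_bounded`,
`exists_lipschitz_weight_of_growth`); from there on both cases are the same.

Let `S` be the smooth transition from 0 to 1 on `[0,1]`, let `Θ_k` be the primitive of `S(k·)`
vanishing at 0, and let `ω(t) = T - t` on `(0,T)`. Test both inequalities with `φ = ω S(kz)` and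
subtract: `f` cancels. Since `∇φ = ω k S'(kz) ∇z`, Young's inequality absorbs the convection term
into the diffusion term and leaves `ω k S'(kz) z² ρ² / (4α)`. As `s² S'(s) ≤ C`, this is at most `T
C ρ² / (4αk)`. Formally the time term dominates `∫ Θ_k(z) (-ω') = ∫ Θ_k(z)`, because `Θ_k` is convex
and `z(·,0) ≤ 0`. Hence `∫ Θ_k(z) ≤ B/k`, and `z⁺ ≤ Θ_k(z) + 1/k` forces `z⁺ = 0` as `k → ∞`.

The delicate point is the time term, since `∂z/∂t` lies only in `L²(0,T; W^{-1,2}) + L¹` and `φ`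
depends on `z`. The dual part is written as `a - div b` with `a, b ∈ L²(Q)`
(`exists_duality_eq_integral`). Testing with time translates of a test function and averaging over
the translation turns the time derivative into a finite difference
(`HasWeakTimeDeriv.integral_timeShift`). This extends by density to bounded `φ ∈ L²(0,T;
W_0^{1,2})`. Convexity of `Θ_k`, a discrete integration by parts and continuity of translations then
give `HasWeakTimeDeriv.chain_rule_le`. -/

noncomputable section

namespace ParabolicComparison

/-! ### Functions of two variables versus `L²`-valued functions of one variable -/

section Slices

variable {X Y E : Type*} [MeasurableSpace X] [MeasurableSpace Y] {μ : Measure X} {ν : Measure Y}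
  [NormedAddCommGroup E]

/-- Along a subsequence with integrals below `2^{-k}` the sum of the series has finite integral, so
the series converges almost everywhere and its terms tend to zero. -/
theorem exists_subseq_ae_tendsto_zero {u : ℕ → Y → ℝ≥0∞} (hu : ∀ n, AEMeasurable (u n) ν)
    (hlim : Tendsto (fun n => ∫⁻ y, u n y ∂ν) atTop (𝓝 0)) :
    ∃ ns : ℕ → ℕ, StrictMono ns ∧ ∀ᵐ y ∂ν, Tendsto (fun k => u (ns k) y) atTop (𝓝 0) := by
  have hev : ∀ k : ℕ, ∀ᶠ n in atTop, ∫⁻ y, u n y ∂ν < (2⁻¹ : ℝ≥0∞) ^ k := fun k =>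
    hlim.eventually_lt_const (ENNReal.pow_pos (by simp) k)
  obtain ⟨ns, hmono, hns⟩ := extraction_forall_of_eventually hev
  refine ⟨ns, hmono, ?_⟩
  have hsum : ∫⁻ y, ∑' k, u (ns k) y ∂ν ≠ ⊤ := by
    rw [lintegral_tsum fun k => hu (ns k)]
    refine ne_top_of_le_ne_top ?_ (ENNReal.tsum_le_tsum fun k => (hns k).le)
    rw [ENNReal.tsum_geometric]
    simp
  filter_upwards [ae_lt_top' (AEMeasurable.tsum fun k => hu (ns k)) hsum] with y hy
  exact ENNReal.tendsto_atTop_zero_of_tsum_ne_top hy.ne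

theorem eLpNorm_two_sq_eq (b : X → E) : eLpNorm b 2 μ ^ 2 = ∫⁻ z, ‖b z‖ₑ ^ 2 ∂μ := by
  have := eLpNorm_nnreal_pow_eq_lintegral (μ := μ) (f := b) (p := 2) two_ne_zero
  simpa using this

theorem lintegral_eLpNorm_two_sq [SFinite μ] [SFinite ν] {a : X × Y → E}
    (ha : AEStronglyMeasurable a (μ.prod ν)) :
    ∫⁻ y, eLpNorm (fun x => a (x, y)) 2 μ ^ 2 ∂ν = eLpNorm a 2 (μ.prod ν) ^ 2 := by
  rw [eLpNorm_two_sq_eq]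
  simp_rw [eLpNorm_two_sq_eq]
  rw [lintegral_prod_symm _ (ha.enorm.pow_const 2)]

theorem aemeasurable_eLpNorm_two_sq [SFinite μ] [SFinite ν] {a : X × Y → E}
    (ha : AEStronglyMeasurable a (μ.prod ν)) :
    AEMeasurable (fun y => eLpNorm (fun x => a (x, y)) 2 μ ^ 2) ν := by
  simp_rw [eLpNorm_two_sq_eq]
  exact (ha.prod_swap.enorm.pow_const 2).lintegral_prod_right'

theorem tendsto_sq_zero_iff {ι : Type*} {l : Filter ι} {u : ι → ℝ≥0∞} :
    Tendsto (fun n => u n ^ 2) l (𝓝 0) ↔ Tendsto u l (𝓝 0) := by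
  constructor
  · intro h
    have h2 := h.ennrpow_const (1 / 2)
    have h3 : (0 : ℝ≥0∞) ^ (1 / 2 : ℝ) = 0 := by simp
    rw [h3] at h2
    refine h2.congr fun n => ?_
    rw [← ENNReal.rpow_natCast, ← ENNReal.rpow_mul]
    simp
  · intro h
    simpa using ENNReal.Tendsto.pow (n := 2) h

/-- Convergence in `L²` of a product gives convergence of almost all slices along a subsequence. -/
theorem exists_subseq_slices [SFinite μ] [SFinite ν] {a : ℕ → X × Y → E}
    (ha : ∀ n, AEStronglyMeasurable (a n) (μ.prod ν))
    (hlim : Tendsto (fun n => eLpNorm (a n) 2 (μ.prod ν)) atTop (𝓝 0)) :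
    ∃ ns : ℕ → ℕ, StrictMono ns ∧
      ∀ᵐ y ∂ν, Tendsto (fun k => eLpNorm (fun x => a (ns k) (x, y)) 2 μ) atTop (𝓝 0) := by
  obtain ⟨ns, hmono, h⟩ := exists_subseq_ae_tendsto_zero
    (fun n => aemeasurable_eLpNorm_two_sq (ha n))
    (by simp_rw [lintegral_eLpNorm_two_sq (ha _)]; exact tendsto_sq_zero_iff.2 hlim)
  exact ⟨ns, hmono, h.mono fun y hy => tendsto_sq_zero_iff.1 hy⟩

/-- `a` is a jointly measurable version of the `L²`-valued function `f`. -/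
def IsUncurrying (μ : Measure X) (ν : Measure Y) (f : Y → Lp E 2 μ) (a : X × Y → E) : Prop :=
  MemLp a 2 (μ.prod ν) ∧ ∀ᵐ y ∂ν, (f y : X → E) =ᵐ[μ] fun x => a (x, y)

/-- This is Tonelli's theorem. Being an isometry, the passage to joint versions preserves Cauchy
sequences. -/
theorem IsUncurrying.eLpNorm_eq [SFinite μ] [SFinite ν] {f : Y → Lp E 2 μ} {a : X × Y → E}
    (h : IsUncurrying μ ν f a) : eLpNorm a 2 (μ.prod ν) = eLpNorm f 2 ν := by
  have h2 : eLpNorm a 2 (μ.prod ν) ^ 2 = eLpNorm f 2 ν ^ 2 := by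
    rw [← lintegral_eLpNorm_two_sq h.1.1, eLpNorm_two_sq_eq]
    refine lintegral_congr_ae (h.2.mono fun y hy => ?_)
    simp only
    rw [Lp.enorm_def, eLpNorm_congr_ae hy]
  exact (ENNReal.pow_right_strictMono two_ne_zero).injective h2

theorem IsUncurrying.sub {f f' : Y → Lp E 2 μ} {a a' : X × Y → E}
    (h : IsUncurrying μ ν f a) (h' : IsUncurrying μ ν f' a') :
    IsUncurrying μ ν (f - f') (a - a') := by
  refine ⟨h.1.sub h'.1, ?_⟩
  filter_upwards [h.2, h'.2] with y hy hy'
  filter_upwards [hy, hy', Lp.coeFn_sub (f y) (f' y)] with x hx hx' hs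
  simp only [Pi.sub_apply] at hs ⊢
  rw [hs, hx, hx']

theorem IsUncurrying.add {f f' : Y → Lp E 2 μ} {a a' : X × Y → E}
    (h : IsUncurrying μ ν f a) (h' : IsUncurrying μ ν f' a') :
    IsUncurrying μ ν (f + f') (a + a') := by
  refine ⟨h.1.add h'.1, ?_⟩
  filter_upwards [h.2, h'.2] with y hy hy'
  filter_upwards [hy, hy', Lp.coeFn_add (f y) (f' y)] with x hx hx' hs
  simp only [Pi.add_apply] at hs ⊢
  rw [hs, hx, hx']

theorem IsUncurrying.congr {f f' : Y → Lp E 2 μ} {a : X × Y → E}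
    (h : IsUncurrying μ ν f a) (hf : f =ᵐ[ν] f') : IsUncurrying μ ν f' a := by
  refine ⟨h.1, ?_⟩
  filter_upwards [h.2, hf] with y hy hy'
  rwa [← hy']

/-- Along a common subsequence, for almost every `y`, both `f n y → f₀ y` and the slices of `a n`
tend to the slice of `a₀` in `L²(μ)`. The two sequences agree, so the limits do. -/
theorem isUncurrying_of_tendsto [SFinite μ] [SFinite ν]
    {f : ℕ → Y → Lp E 2 μ} {a : ℕ → X × Y → E}
    (h : ∀ n, IsUncurrying μ ν (f n) (a n)) {f₀ : Y → Lp E 2 μ} {a₀ : X × Y → E}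
    (hf₀ : AEStronglyMeasurable f₀ ν) (hf : ∀ n, AEStronglyMeasurable (f n) ν)
    (ha₀ : MemLp a₀ 2 (μ.prod ν))
    (hfl : Tendsto (fun n => eLpNorm (f n - f₀) 2 ν) atTop (𝓝 0))
    (hal : Tendsto (fun n => eLpNorm (a n - a₀) 2 (μ.prod ν)) atTop (𝓝 0)) :
    IsUncurrying μ ν f₀ a₀ := by
  refine ⟨ha₀, ?_⟩
  obtain ⟨ns, hns, h1⟩ := exists_subseq_slices (fun n => ((h n).1.1.sub ha₀.1)) hal
  have h2 := (hfl.comp hns.tendsto_atTop)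
  obtain ⟨ms, hms, h3⟩ := exists_subseq_ae_tendsto_zero (ν := ν)
    (u := fun n y => ‖f (ns n) y - f₀ y‖ₑ ^ 2)
    (fun n => ((hf (ns n)).sub hf₀).enorm.pow_const 2) (by
      have := tendsto_sq_zero_iff.2 h2
      simpa only [Function.comp_def, eLpNorm_two_sq_eq, Pi.sub_apply] using this)
  have h4 : ∀ᵐ y ∂ν, ∀ n, (f n y : X → E) =ᵐ[μ] fun x => a n (x, y) :=
    ae_all_iff.2 fun n => (h n).2
  filter_upwards [h1, h3, h4, ha₀.1.prodMk_right, ae_all_iff.2 fun n => (h n).1.1.prodMk_right]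
    with y hy1 hy3 hy4 hm0 hm
  have hy3' := tendsto_sq_zero_iff.1 hy3
  have hy1' := hy1.comp hms.tendsto_atTop
  have hle : ∀ k, eLpNorm (fun x => f₀ y x - a₀ (x, y)) 2 μ ≤
      ‖f (ns (ms k)) y - f₀ y‖ₑ +
        eLpNorm (fun x => (a (ns (ms k)) - a₀) (x, y)) 2 μ := by
    intro k
    have e1 : (fun x => f₀ y x - a₀ (x, y)) =ᵐ[μ]
        (-⇑(f (ns (ms k)) y - f₀ y)) + fun x => (a (ns (ms k)) - a₀) (x, y) := by
      filter_upwards [hy4 (ns (ms k)), Lp.coeFn_sub (f (ns (ms k)) y) (f₀ y)] with x hx1 hx2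
      simp only [Pi.add_apply, Pi.neg_apply]
      rw [hx2]
      simp only [Pi.sub_apply]
      rw [hx1]
      abel
    have e2 : AEStronglyMeasurable (fun x => (a (ns (ms k)) - a₀) (x, y)) μ := (hm _).sub hm0
    have e3 := eLpNorm_add_le (Lp.aestronglyMeasurable (f (ns (ms k)) y - f₀ y)).neg e2
      (one_le_two (α := ℝ≥0∞))
    rw [← eLpNorm_congr_ae e1, eLpNorm_neg, ← Lp.enorm_def] at e3
    exact e3
  have hz : eLpNorm (fun x => f₀ y x - a₀ (x, y)) 2 μ ≤ 0 := by
    have hsum := hy3'.add hy1'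
    rw [add_zero] at hsum
    exact ge_of_tendsto hsum (Eventually.of_forall hle)
  have hz' := (eLpNorm_eq_zero_iff ((Lp.aestronglyMeasurable (f₀ y)).sub hm0) two_ne_zero).1
    (le_antisymm hz bot_le)
  filter_upwards [hz'] with x hx
  exact sub_eq_zero.1 hx

/-- A joint version is evident for `1_s(y) c(x)`. The property survives sums and, by the isometry
above, `L²` limits, so `Lp.induction` applies. -/
theorem exists_isUncurrying [SFinite μ] [SFinite ν] [CompleteSpace E]
    {f : Y → Lp E 2 μ} (hf : MemLp f 2 ν) : ∃ a : X × Y → E, IsUncurrying μ ν f a := by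
  have key : ∀ F : Lp (Lp E 2 μ) 2 ν, ∃ a : X × Y → E, IsUncurrying μ ν F a := by
    intro F
    refine Lp.induction (p := 2) (by simp) (motive := fun F => ∃ a : X × Y → E,
      IsUncurrying μ ν F a) ?_ ?_ ?_ F
    · intro c s hs hμs
      have h0 : IsUncurrying μ ν (s.indicator fun _ => c)
          (fun p : X × Y => s.indicator (fun _ => c p.1) p.2) := by
        have hm : AEStronglyMeasurable (fun p : X × Y => s.indicator (fun _ => c p.1) p.2)
            (μ.prod ν) := by
          have : (fun p : X × Y => s.indicator (fun _ => c p.1) p.2) =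
              (Prod.snd ⁻¹' s).indicator (fun p : X × Y => c p.1) := by
            ext p; simp only [indicator, mem_preimage]; congr
          rw [this]
          exact ((Lp.aestronglyMeasurable c).comp_fst).indicator (measurable_snd hs)
        refine ⟨⟨hm, ?_⟩, ?_⟩
        · have hlt : eLpNorm (fun p : X × Y => s.indicator (fun _ => c p.1) p.2) 2 (μ.prod ν) ^ 2
              < ⊤ := by
            rw [← lintegral_eLpNorm_two_sq hm]
            have : ∀ y, eLpNorm (fun x => s.indicator (fun _ => c x) y) 2 μ ^ 2 =
                s.indicator (fun _ => eLpNorm c 2 μ ^ 2) y := by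
              intro y
              by_cases hy : y ∈ s <;> simp [hy]
            simp_rw [this]
            rw [lintegral_indicator hs, setLIntegral_const]
            exact ENNReal.mul_lt_top (ENNReal.pow_lt_top (Lp.memLp c).2) hμs
          by_contra hcon
          rw [not_lt, top_le_iff] at hcon
          rw [hcon] at hlt
          simp at hlt
        · refine Eventually.of_forall fun y => ?_
          by_cases hy : y ∈ s
          · simp [hy]
          · simp only [hy, not_false_eq_true, indicator_of_notMem]
            exact Lp.coeFn_zero _ _ _
      refine ⟨_, h0.congr ?_⟩
      rw [Lp.simpleFunc.coe_indicatorConst]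
      exact indicatorConstLp_coeFn.symm
    · rintro f g hf hg - ⟨a, ha⟩ ⟨b, hb⟩
      exact ⟨a + b, (ha.add hb).congr (Lp.coeFn_add _ _).symm⟩
    · refine IsSeqClosed.isClosed ?_
      intro F F₀ hF hlim
      choose a ha using hF
      -- Distances between joint versions equal distances between the vector-valued functions, so
      -- the joint versions converge in `L²(μ ⊗ ν)`.
      have hd : ∀ n m, dist ((ha n).1.toLp (a n)) ((ha m).1.toLp (a m)) = dist (F n) (F m) := by
        intro n m
        rw [Lp.dist_def, Lp.dist_def]
        congr 1
        rw [← ((ha n).sub (ha m)).eLpNorm_eq]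
        exact eLpNorm_congr_ae ((ha n).1.coeFn_toLp.sub (ha m).1.coeFn_toLp)
      have hC : CauchySeq fun n => (ha n).1.toLp (a n) := by
        have hC' := hlim.cauchySeq
        rw [Metric.cauchySeq_iff] at hC' ⊢
        simpa only [hd] using hC'
      obtain ⟨A, hA⟩ := cauchySeq_tendsto_of_complete hC
      refine ⟨A, isUncurrying_of_tendsto ha (Lp.aestronglyMeasurable _)
        (fun n => Lp.aestronglyMeasurable _) (Lp.memLp A)
        ((Lp.tendsto_Lp_iff_tendsto_eLpNorm' _ _).1 hlim) ?_⟩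
      refine ((Lp.tendsto_Lp_iff_tendsto_eLpNorm' _ _).1 hA).congr fun n => ?_
      exact eLpNorm_congr_ae ((ha n).1.coeFn_toLp.sub EventuallyEq.rfl)
  obtain ⟨a, ha⟩ := key (hf.toLp f)
  exact ⟨a, ha.congr hf.coeFn_toLp⟩

end Slices

/-! ### Representation of `L²(0,T; W^{-1,2}(Ω))` -/

section Duality

variable {N : ℕ} {Ω : Set (Sp N)} {T : ℝ}

theorem volume_restrict_cylinder (Ω : Set (Sp N)) (T : ℝ) :
    volume.restrict (cylinder Ω T) = (vol Ω).prod (volume.restrict (Ioo 0 T)) := by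
  rw [cylinder, Measure.volume_eq_prod, Measure.prod_restrict]

instance completeSpace_W012 (Ω : Set (Sp N)) : CompleteSpace (W012 Ω) := by
  unfold W012
  exact Submodule.topologicalClosure.completeSpace _

theorem inner_W012 (p q : W012 Ω) :
    inner ℝ p q = inner ℝ p.1.fst q.1.fst + inner ℝ p.1.snd q.1.snd := by
  rw [Submodule.coe_inner, WithLp.prod_inner_apply]
  rfl

theorem norm_fst_W012_le (p : W012 Ω) : ‖p.1.fst‖ ≤ ‖p‖ :=
  (WithLp.norm_fst_le _ p.1).trans (Submodule.coe_norm p).le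

theorem norm_snd_W012_le (p : W012 Ω) : ‖p.1.snd‖ ≤ ‖p‖ :=
  (WithLp.norm_snd_le _ p.1).trans (Submodule.coe_norm p).le

theorem Represents.toW012 {u : Sp N → ℝ} {Du : Sp N → Sp N} (h : ∃ p : W012 Ω, Represents Ω p u Du) :
    Represents Ω (toW012 Ω u Du) u Du := by
  unfold ParabolicComparison.toW012
  rw [dif_pos h]
  exact h.choose_spec

theorem MemLp.integrable_mul_two {X : Type*} [MeasurableSpace X] {μ : Measure X} {a b : X → ℝ}
    (ha : MemLp a 2 μ) (hb : MemLp b 2 μ) : Integrable (fun x => a x * b x) μ :=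
  ha.integrable_mul hb

theorem MemLp.integrable_inner_two {X E : Type*} [MeasurableSpace X] {μ : Measure X}
    [NormedAddCommGroup E] [InnerProductSpace ℝ E] {a b : X → E}
    (ha : MemLp a 2 μ) (hb : MemLp b 2 μ) : Integrable (fun x => inner ℝ (a x) (b x)) μ := by
  refine (ha.norm.integrable_mul hb.norm).mono (ha.1.inner hb.1) (Eventually.of_forall fun x => ?_)
  simpa using norm_inner_le_norm (𝕜 := ℝ) (a x) (b x)

/-- An element of `L²(0,T; W^{-1,2}(Ω))` is given by a pair of functions in `L²(Q)`. -/
theorem exists_duality_eq_integral {F : ℝ → Wm12 Ω} (hF : MemL2Wm12 Ω T F) :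
    ∃ (a : Sp N × ℝ → ℝ) (b : Sp N × ℝ → Sp N),
      MemLp a 2 (volume.restrict (cylinder Ω T)) ∧ MemLp b 2 (volume.restrict (cylinder Ω T)) ∧
      ∀ φ Dφ, MemL2W012 Ω T φ Dφ → duality Ω T F φ Dφ =
        (∫ p in cylinder Ω T, a p * φ p) + ∫ p in cylinder Ω T, inner ℝ (b p) (Dφ p) := by
  -- Riesz representation in the Hilbert space `W012 Ω`, for each `t`. The representative `r t` is a
  -- pair (function, gradient), and its two components, made jointly measurable, are `a` and `b`.
  obtain ⟨r, hrm, hrF⟩ : ∃ r : ℝ → W012 Ω, MemLp r 2 (volume.restrict (Ioo 0 T)) ∧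
      ∀ t p, F t p = inner ℝ (r t) p := by
    have hc := (InnerProductSpace.toDual ℝ (W012 Ω)).symm.continuous
    have hn := (InnerProductSpace.toDual ℝ (W012 Ω)).symm.norm_map
    refine ⟨fun t => (InnerProductSpace.toDual ℝ (W012 Ω)).symm (F t), ?_,
      fun t p => (InnerProductSpace.toDual_symm_apply).symm⟩
    have hF' : MemLp F 2 (volume.restrict (Ioo 0 T)) := hF
    refine MemLp.of_le (E := W012 Ω) (F := Wm12 Ω) (g := F) hF' ?_ ?_
    · exact hc.comp_aestronglyMeasurable hF'.1
    · exact Eventually.of_forall fun t => (hn (F t)).le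
  have c1 : Continuous fun p : W012 Ω => p.1.fst :=
    (WithLp.continuous_fst ..).comp continuous_subtype_val
  have c2 : Continuous fun p : W012 Ω => p.1.snd :=
    (WithLp.continuous_snd ..).comp continuous_subtype_val
  have hr1 : MemLp (fun t => (r t).1.fst) 2 (volume.restrict (Ioo 0 T)) :=
    MemLp.of_le hrm (c1.comp_aestronglyMeasurable hrm.1)
      (Eventually.of_forall fun t => norm_fst_W012_le (r t))
  have hr2 : MemLp (fun t => (r t).1.snd) 2 (volume.restrict (Ioo 0 T)) :=
    MemLp.of_le hrm (c2.comp_aestronglyMeasurable hrm.1)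
      (Eventually.of_forall fun t => norm_snd_W012_le (r t))
  obtain ⟨a, ha, haf⟩ := exists_isUncurrying hr1
  obtain ⟨b, hb, hbf⟩ := exists_isUncurrying hr2
  rw [← volume_restrict_cylinder] at ha hb
  refine ⟨a, b, ha, hb, fun φ Dφ hφ => ?_⟩
  obtain ⟨h1, h2, h3⟩ := hφ
  have i1 := MemLp.integrable_mul_two ha h1
  have i2 := MemLp.integrable_inner_two hb h2
  rw [volume_restrict_cylinder] at i1 i2 ⊢
  rw [integral_prod_symm _ i1, integral_prod_symm _ i2, ← integral_add i1.integral_prod_right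
    i2.integral_prod_right, duality]
  refine integral_congr_ae ?_
  filter_upwards [haf, hbf, h3] with t hat hbt hpt
  have hp := Represents.toW012 hpt
  rw [hrF, inner_W012, L2.inner_def, L2.inner_def]
  congr 1
  · refine integral_congr_ae ?_
    filter_upwards [hat, hp.1] with x hx hx'
    rw [hx, hx']
    simp [mul_comm]
  · refine integral_congr_ae ?_
    filter_upwards [hbt, hp.2] with x hx hx'
    rw [hx, hx']

end Duality

/-! ### Algebra of test functions -/

section TestFunctions

variable {X : Type*} [NormedAddCommGroup X] [NormedSpace ℝ X] {U V : Set X} {ψ ψ' : X → ℝ}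

theorem IsTestFunction.comp (hψ : IsTestFunction U ψ) {S : ℝ → ℝ} (hS : ContDiff ℝ ∞ S)
    (hS0 : S 0 = 0) : IsTestFunction U (S ∘ ψ) :=
  ⟨hS.comp hψ.1, hψ.2.1.comp_left hS0, (tsupport_comp_subset hS0 ψ).trans hψ.2.2⟩

theorem IsTestFunction.add (hψ : IsTestFunction U ψ) (hψ' : IsTestFunction U ψ') :
    IsTestFunction U (ψ + ψ') :=
  ⟨hψ.1.add hψ'.1, hψ.2.1.add hψ'.2.1,
    (tsupport_add ψ ψ').trans (union_subset hψ.2.2 hψ'.2.2)⟩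

theorem IsTestFunction.smul (c : ℝ) (hψ : IsTestFunction U ψ) : IsTestFunction U (c • ψ) := by
  have := hψ.comp (S := fun s => c * s) (contDiff_const.mul contDiff_id) (by simp)
  exact this

theorem IsTestFunction.zero : IsTestFunction U (0 : X → ℝ) := by
  refine ⟨contDiff_const, HasCompactSupport.zero, ?_⟩
  have h : tsupport (fun _ : X => (0 : ℝ)) = ∅ := by simp
  exact h.trans_subset (empty_subset _)

theorem IsTestFunction.eq_zero_of_notMem (hψ : IsTestFunction U ψ) {x : X} (hx : x ∉ U) :
    ψ x = 0 :=
  image_eq_zero_of_notMem_tsupport fun h => hx (hψ.2.2 h)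

end TestFunctions

/-! ### Classical spatial gradients -/

section Gradients

variable {N : ℕ} {Ω : Set (Sp N)} {T : ℝ}

theorem gradient_eq (ζ : Sp N → ℝ) : ∇ ζ = fun x => (InnerProductSpace.toDual ℝ (Sp N)).symm
    (fderiv ℝ ζ x) := rfl

theorem spaceGrad_eq {ψ : Sp N × ℝ → ℝ} (hψ : Differentiable ℝ ψ) :
    spaceGrad ψ = fun p => (InnerProductSpace.toDual ℝ (Sp N)).symm
      ((fderiv ℝ ψ p).comp (ContinuousLinearMap.inl ℝ (Sp N) ℝ)) := by
  ext1 p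
  have h1 : HasFDerivAt (fun y : Sp N => (y, p.2)) (ContinuousLinearMap.inl ℝ (Sp N) ℝ) p.1 :=
    hasFDerivAt_prodMk_left p.1 p.2
  exact ((hψ p).hasFDerivAt.comp p.1 h1).hasGradientAt.gradient

theorem continuous_gradient {ζ : Sp N → ℝ} (hζ : ContDiff ℝ ∞ ζ) : Continuous (∇ ζ) := by
  rw [gradient_eq]
  exact (InnerProductSpace.toDual ℝ (Sp N)).symm.continuous.comp
    (hζ.continuous_fderiv (by simp))

theorem hasCompactSupport_gradient {ζ : Sp N → ℝ} (hζ : HasCompactSupport ζ) :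
    HasCompactSupport (∇ ζ) := by
  rw [gradient_eq]
  exact (hζ.fderiv ℝ).comp_left (LinearIsometryEquiv.map_zero _)

theorem continuous_spaceGrad {ψ : Sp N × ℝ → ℝ} (hψ : ContDiff ℝ ∞ ψ) :
    Continuous (spaceGrad ψ) := by
  rw [spaceGrad_eq (hψ.differentiable (by simp))]
  exact (InnerProductSpace.toDual ℝ (Sp N)).symm.continuous.comp
    ((hψ.continuous_fderiv (by simp)).clm_comp continuous_const)

theorem hasCompactSupport_spaceGrad {ψ : Sp N × ℝ → ℝ} (hψ : ContDiff ℝ ∞ ψ)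
    (hc : HasCompactSupport ψ) : HasCompactSupport (spaceGrad ψ) := by
  rw [spaceGrad_eq (hψ.differentiable (by simp))]
  exact (hc.fderiv ℝ).comp_left (g := fun L => (InnerProductSpace.toDual ℝ (Sp N)).symm
    (ContinuousLinearMap.comp L (ContinuousLinearMap.inl ℝ (Sp N) ℝ))) (by simp)

theorem spaceGrad_eq_zero {ψ : Sp N × ℝ → ℝ} {U : Set (Sp N × ℝ)} (hψ : IsTestFunction U ψ)
    {p : Sp N × ℝ} (hp : p ∉ U) : spaceGrad ψ p = 0 := by
  rw [spaceGrad_eq (hψ.1.differentiable (by simp))]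
  have : fderiv ℝ ψ p = 0 := by
    by_contra h
    exact hp (hψ.2.2 (support_fderiv_subset ℝ h))
  simp [this]

theorem gradient_comp {ζ : Sp N → ℝ} {x : Sp N} (hζ : DifferentiableAt ℝ ζ x) {S : ℝ → ℝ}
    (hS : Differentiable ℝ S) : ∇ (S ∘ ζ) x = deriv S (ζ x) • ∇ ζ x := by
  have h := (hS (ζ x)).hasDerivAt.comp_hasFDerivAt x hζ.hasFDerivAt
  rw [h.hasGradientAt.gradient, gradient_eq]
  simp

theorem spaceGrad_comp {ψ : Sp N × ℝ → ℝ} (hψ : Differentiable ℝ ψ) {S : ℝ → ℝ}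
    (hS : Differentiable ℝ S) : spaceGrad (S ∘ ψ) = fun p => deriv S (ψ p) • spaceGrad ψ p := by
  ext1 p
  have h1 : DifferentiableAt ℝ (fun y : Sp N => (y, p.2)) p.1 :=
    (hasFDerivAt_prodMk_left p.1 p.2).differentiableAt
  exact gradient_comp ((hψ p).comp p.1 h1) hS

theorem gradient_add {ζ ζ' : Sp N → ℝ} (h : Differentiable ℝ ζ) (h' : Differentiable ℝ ζ') :
    ∇ (ζ + ζ') = ∇ ζ + ∇ ζ' := by
  ext1 x
  simp only [gradient_eq, Pi.add_apply]
  rw [fderiv_add (h x) (h' x), map_add]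

theorem gradient_smul {ζ : Sp N → ℝ} (h : Differentiable ℝ ζ) (c : ℝ) : ∇ (c • ζ) = c • ∇ ζ := by
  ext1 x
  simp only [gradient_eq, Pi.smul_apply]
  rw [fderiv_const_smul (h x), map_smulₛₗ]
  simp

theorem spaceGrad_add {ψ ψ' : Sp N × ℝ → ℝ} (h : Differentiable ℝ ψ) (h' : Differentiable ℝ ψ') :
    spaceGrad (ψ + ψ') = spaceGrad ψ + spaceGrad ψ' := by
  ext1 p
  exact congrFun (gradient_add (fun y => (h (y, p.2)).comp y
      (hasFDerivAt_prodMk_left y p.2).differentiableAt)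
    (fun y => (h' (y, p.2)).comp y (hasFDerivAt_prodMk_left y p.2).differentiableAt)) p.1

theorem spaceGrad_smul {ψ : Sp N × ℝ → ℝ} (h : Differentiable ℝ ψ) (c : ℝ) :
    spaceGrad (c • ψ) = c • spaceGrad ψ := by
  ext1 p
  exact congrFun (gradient_smul (fun y => (h (y, p.2)).comp y
    (hasFDerivAt_prodMk_left y p.2).differentiableAt) c) p.1

end Gradients

/-! ### Smooth Lipschitz functions acting on `L²` limits -/

section Composition

variable {X V : Type*} [MeasurableSpace X] {μ : Measure X} [NormedAddCommGroup V]
  [NormedSpace ℝ V]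

theorem abs_sub_le_of_abs_deriv_le {S : ℝ → ℝ} (hS : Differentiable ℝ S) {C : ℝ}
    (hC : ∀ s, |deriv S s| ≤ C) (a b : ℝ) : |S a - S b| ≤ C * |a - b| :=
  convex_univ.norm_image_sub_le_of_norm_deriv_le (fun x _ => hS x) (fun x _ => hC x)
    (mem_univ b) (mem_univ a)

theorem tendsto_eLpNorm_smul_of_ae_tendsto {c : ℕ → X → ℝ} {F : X → V} {C : ℝ}
    (hF : MemLp F 2 μ) (hcm : ∀ n, AEStronglyMeasurable (c n) μ) (hC : ∀ n, ∀ᵐ x ∂μ, |c n x| ≤ C)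
    (hc : ∀ᵐ x ∂μ, Tendsto (fun n => c n x) atTop (𝓝 0)) :
    Tendsto (fun n => eLpNorm (fun x => c n x • F x) 2 μ) atTop (𝓝 0) := by
  rw [← tendsto_sq_zero_iff]
  simp_rw [eLpNorm_two_sq_eq]
  have h0 : ∫⁻ _, 0 ∂μ = 0 := lintegral_zero
  rw [← h0]
  refine tendsto_lintegral_of_dominated_convergence' (fun x => ‖C * ‖F x‖‖ₑ ^ 2)
    (fun n => ((hcm n).smul hF.1).enorm.pow_const 2) (fun n => ?_) ?_ ?_
  · filter_upwards [hC n] with x hx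
    gcongr
    rw [enorm_le_iff_norm_le, norm_smul, norm_mul, norm_norm]
    gcongr
    exact hx.trans (le_abs_self C)
  · rw [← eLpNorm_two_sq_eq]
    exact (ENNReal.pow_lt_top (hF.norm.const_mul C).2).ne
  · filter_upwards [hc] with x hx
    have h1 : Tendsto (fun n => c n x • F x) atTop (𝓝 0) := by
      simpa using hx.smul_const (F x)
    have h2 := (continuous_enorm.tendsto _).comp h1
    rw [enorm_zero] at h2
    exact tendsto_sq_zero_iff.2 h2

/-- Split `S'(f_n) F_n - S'(f₀) F₀ = S'(f_n)(F_n - F₀) + (S'(f_n) - S'(f₀)) F₀`. The first term is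
controlled by the bound on `S'`. The second needs dominated convergence, hence almost everywhere
convergence of `f_n`, hence a subsequence. -/
theorem exists_subseq_comp_tendsto {f : ℕ → X → ℝ} {f₀ : X → ℝ} {F : ℕ → X → V} {F₀ : X → V}
    (hf : ∀ n, AEStronglyMeasurable (f n) μ) (hf₀ : AEStronglyMeasurable f₀ μ)
    (hF : ∀ n, AEStronglyMeasurable (F n) μ) (hF₀ : MemLp F₀ 2 μ)
    (hlim : Tendsto (fun n => eLpNorm (f n - f₀) 2 μ) atTop (𝓝 0))
    (hLim : Tendsto (fun n => eLpNorm (F n - F₀) 2 μ) atTop (𝓝 0))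
    {S : ℝ → ℝ} (hS : ContDiff ℝ ∞ S) {C : ℝ} (hC : ∀ s, |deriv S s| ≤ C) :
    ∃ ns : ℕ → ℕ, StrictMono ns ∧
      (∀ᵐ x ∂μ, Tendsto (fun k => f (ns k) x) atTop (𝓝 (f₀ x))) ∧
      Tendsto (fun k => eLpNorm (S ∘ f (ns k) - S ∘ f₀) 2 μ) atTop (𝓝 0) ∧
      Tendsto (fun k => eLpNorm ((fun x => deriv S (f (ns k) x) • F (ns k) x) -
        fun x => deriv S (f₀ x) • F₀ x) 2 μ) atTop (𝓝 0) := by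
  have hC0 : 0 ≤ C := (abs_nonneg _).trans (hC 0)
  have hSd : Continuous (deriv S) := hS.continuous_deriv (by simp)
  obtain ⟨ns, hns, hae⟩ := (tendstoInMeasure_of_tendsto_eLpNorm two_ne_zero hf hf₀
    hlim).exists_seq_tendsto_ae
  refine ⟨ns, hns, hae, ?_, ?_⟩
  · have h1 : Tendsto (fun k => ENNReal.ofReal C * eLpNorm (f (ns k) - f₀) 2 μ) atTop (𝓝 0) := by
      have := ENNReal.Tendsto.const_mul (a := ENNReal.ofReal C) (hlim.comp hns.tendsto_atTop)
        (Or.inr ENNReal.ofReal_ne_top)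
      simpa using this
    refine tendsto_of_tendsto_of_tendsto_of_le_of_le tendsto_const_nhds h1 (fun _ => zero_le)
      fun k => ?_
    exact eLpNorm_le_mul_eLpNorm_of_ae_le_mul (Eventually.of_forall fun x =>
      abs_sub_le_of_abs_deriv_le (hS.differentiable (by simp)) hC _ _) 2
  · have hm : ∀ k, AEStronglyMeasurable (fun x => deriv S (f (ns k) x)) μ := fun k =>
      hSd.comp_aestronglyMeasurable (hf (ns k))
    have hm₀ : AEStronglyMeasurable (fun x => deriv S (f₀ x)) μ :=
      hSd.comp_aestronglyMeasurable hf₀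
    have h1 : Tendsto (fun k => ENNReal.ofReal C * eLpNorm (F (ns k) - F₀) 2 μ) atTop (𝓝 0) := by
      have := ENNReal.Tendsto.const_mul (a := ENNReal.ofReal C) (hLim.comp hns.tendsto_atTop)
        (Or.inr ENNReal.ofReal_ne_top)
      simpa using this
    have h2 : Tendsto (fun k => eLpNorm (fun x => (deriv S (f (ns k) x) - deriv S (f₀ x)) • F₀ x)
        2 μ) atTop (𝓝 0) := by
      refine tendsto_eLpNorm_smul_of_ae_tendsto (C := C + C) hF₀ (fun k => (hm k).sub hm₀)
        (fun k => Eventually.of_forall fun x => (abs_sub _ _).trans (add_le_add (hC _) (hC _))) ?_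
      filter_upwards [hae] with x hx
      simpa using ((hSd.tendsto _).comp hx).sub_const (deriv S (f₀ x))
    have h3 := h1.add h2
    rw [add_zero] at h3
    refine tendsto_of_tendsto_of_tendsto_of_le_of_le tendsto_const_nhds h3 (fun _ => zero_le)
      fun k => ?_
    have e : ((fun x => deriv S (f (ns k) x) • F (ns k) x) - fun x => deriv S (f₀ x) • F₀ x) =
        (fun x => deriv S (f (ns k) x) • (F (ns k) - F₀) x) +
          fun x => (deriv S (f (ns k) x) - deriv S (f₀ x)) • F₀ x := by
      ext x
      simp only [Pi.sub_apply, Pi.add_apply, smul_sub, sub_smul]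
      abel
    simp only
    rw [e]
    refine (eLpNorm_add_le ((hm k).smul ((hF (ns k)).sub hF₀.1))
      (((hm k).sub hm₀).smul hF₀.1) one_le_two).trans (add_le_add_left ?_ _)
    refine eLpNorm_le_mul_eLpNorm_of_ae_le_mul (Eventually.of_forall fun x => ?_) 2
    rw [Pi.smul_apply', norm_smul]
    gcongr
    exact hC _

end Composition

/-! ### Pairs (function, gradient) in `L² × L²` -/

section Pairs

variable {X V : Type*} [MeasurableSpace X] {μ : Measure X} [NormedAddCommGroup V]

/-- A function together with a vector field, as an element of `L² × L²`. -/
def toPair {u : X → ℝ} {Du : X → V} (hu : MemLp u 2 μ) (hDu : MemLp Du 2 μ) :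
    WithLp 2 (Lp ℝ 2 μ × Lp V 2 μ) :=
  WithLp.toLp 2 (hu.toLp u, hDu.toLp Du)

theorem coeFn_toPair_fst {u : X → ℝ} {Du : X → V} (hu : MemLp u 2 μ) (hDu : MemLp Du 2 μ) :
    ((toPair hu hDu).fst : X → ℝ) =ᵐ[μ] u := hu.coeFn_toLp

theorem coeFn_toPair_snd {u : X → ℝ} {Du : X → V} (hu : MemLp u 2 μ) (hDu : MemLp Du 2 μ) :
    ((toPair hu hDu).snd : X → V) =ᵐ[μ] Du := hDu.coeFn_toLp

theorem tendsto_toPair {u : ℕ → X → ℝ} {Du : ℕ → X → V} (hu : ∀ n, MemLp (u n) 2 μ)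
    (hDu : ∀ n, MemLp (Du n) 2 μ) {u₀ : X → ℝ} {Du₀ : X → V} (hu₀ : MemLp u₀ 2 μ)
    (hDu₀ : MemLp Du₀ 2 μ) (h : Tendsto (fun n => eLpNorm (u n - u₀) 2 μ) atTop (𝓝 0))
    (hD : Tendsto (fun n => eLpNorm (Du n - Du₀) 2 μ) atTop (𝓝 0)) :
    Tendsto (fun n => toPair (hu n) (hDu n)) atTop (𝓝 (toPair hu₀ hDu₀)) := by
  have h1 := (Lp.tendsto_Lp_iff_tendsto_eLpNorm'' u hu u₀ hu₀).2 h
  have h2 := (Lp.tendsto_Lp_iff_tendsto_eLpNorm'' Du hDu Du₀ hDu₀).2 hD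
  exact ((WithLp.prod_continuous_toLp 2 _ _).tendsto _).comp (h1.prodMk_nhds h2)

theorem tendsto_eLpNorm_of_tendsto_pair {p : ℕ → WithLp 2 (Lp ℝ 2 μ × Lp V 2 μ)}
    {p₀ : WithLp 2 (Lp ℝ 2 μ × Lp V 2 μ)} (h : Tendsto p atTop (𝓝 p₀))
    {u : ℕ → X → ℝ} {Du : ℕ → X → V} {u₀ : X → ℝ} {Du₀ : X → V}
    (hu : ∀ n, ((p n).fst : X → ℝ) =ᵐ[μ] u n) (hDu : ∀ n, ((p n).snd : X → V) =ᵐ[μ] Du n)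
    (hu₀ : (p₀.fst : X → ℝ) =ᵐ[μ] u₀) (hDu₀ : (p₀.snd : X → V) =ᵐ[μ] Du₀) :
    Tendsto (fun n => eLpNorm (u n - u₀) 2 μ) atTop (𝓝 0) ∧
      Tendsto (fun n => eLpNorm (Du n - Du₀) 2 μ) atTop (𝓝 0) := by
  have h1 := ((WithLp.continuous_fst 2 (Lp ℝ 2 μ) (Lp V 2 μ)).tendsto p₀).comp h
  have h2 := ((WithLp.continuous_snd 2 (Lp ℝ 2 μ) (Lp V 2 μ)).tendsto p₀).comp h
  constructor
  · refine ((Lp.tendsto_Lp_iff_tendsto_eLpNorm' _ _).1 h1).congr fun n => ?_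
    exact eLpNorm_congr_ae ((hu n).sub hu₀)
  · refine ((Lp.tendsto_Lp_iff_tendsto_eLpNorm' _ _).1 h2).congr fun n => ?_
    exact eLpNorm_congr_ae ((hDu n).sub hDu₀)

/-- The set `G` is already a subspace, so the span adds nothing: elements of the closure are limits
of genuine test functions, not merely of their linear combinations. -/
theorem exists_seq_of_mem_topologicalClosure_span {H : Type*} [NormedAddCommGroup H]
    [NormedSpace ℝ H] {G : Set H} (h0 : (0 : H) ∈ G) (hadd : ∀ x ∈ G, ∀ y ∈ G, x + y ∈ G)
    (hsmul : ∀ (c : ℝ), ∀ x ∈ G, c • x ∈ G) {p : H}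
    (hp : p ∈ (Submodule.span ℝ G).topologicalClosure) :
    ∃ q : ℕ → H, (∀ n, q n ∈ G) ∧ Tendsto q atTop (𝓝 p) := by
  have hle : (Submodule.span ℝ G : Set H) ⊆ G := by
    let K : Submodule ℝ H :=
      { carrier := G
        add_mem' := fun {a b} ha hb => hadd a ha b hb
        zero_mem' := h0
        smul_mem' := fun c x hx => hsmul c x hx }
    exact (Submodule.span_le (p := K)).2 (subset_refl G)
  have hp' : p ∈ closure G := closure_mono hle hp
  exact mem_closure_iff_seq_limit.1 hp'

end Pairs

/-! ### Calculus in `W_0^{1,2}(Ω)` and `L²(0,T; W_0^{1,2}(Ω))` -/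

section Sobolev

variable {N : ℕ} {Ω : Set (Sp N)} {T : ℝ}

theorem IsTestFunction.memLp {X : Type*} [NormedAddCommGroup X] [NormedSpace ℝ X]
    [MeasurableSpace X] [BorelSpace X] {μ : Measure X} [IsFiniteMeasureOnCompacts μ]
    {U : Set X} {ψ : X → ℝ} (hψ : IsTestFunction U ψ) (q : ℝ≥0∞) : MemLp ψ q μ :=
  hψ.1.continuous.memLp_of_hasCompactSupport hψ.2.1

theorem IsTestFunction.memLp_gradient {μ : Measure (Sp N)} [IsFiniteMeasureOnCompacts μ]
    {ζ : Sp N → ℝ} (hζ : IsTestFunction Ω ζ) (q : ℝ≥0∞) : MemLp (∇ ζ) q μ :=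
  (continuous_gradient hζ.1).memLp_of_hasCompactSupport (hasCompactSupport_gradient hζ.2.1)

theorem IsTestFunction.memLp_spaceGrad {μ : Measure (Sp N × ℝ)} [IsFiniteMeasureOnCompacts μ]
    {U : Set (Sp N × ℝ)} {ψ : Sp N × ℝ → ℝ} (hψ : IsTestFunction U ψ) (q : ℝ≥0∞) :
    MemLp (spaceGrad ψ) q μ :=
  (continuous_spaceGrad hψ.1).memLp_of_hasCompactSupport (hasCompactSupport_spaceGrad hψ.1 hψ.2.1)

/-- The pairs `(ζ, ∇ζ)` with `ζ ∈ C_c^∞(Ω)`. -/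
def testPairs (Ω : Set (Sp N)) : Set (WithLp 2 (Lp ℝ 2 (vol Ω) × Lp (Sp N) 2 (vol Ω))) :=
  {p | ∃ ζ : Sp N → ℝ, IsTestFunction Ω ζ ∧
    (p.fst : Sp N → ℝ) =ᵐ[vol Ω] ζ ∧ (p.snd : Sp N → Sp N) =ᵐ[vol Ω] ∇ ζ}

theorem toPair_mem_testPairs {ζ : Sp N → ℝ} (hζ : IsTestFunction Ω ζ) :
    toPair (hζ.memLp 2) (hζ.memLp_gradient 2) ∈ testPairs Ω :=
  ⟨ζ, hζ, coeFn_toPair_fst _ _, coeFn_toPair_snd _ _⟩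

theorem testPairs_subset_W012 : testPairs Ω ⊆ W012 Ω := fun _ hp =>
  (Submodule.span ℝ (testPairs Ω)).le_topologicalClosure (Submodule.subset_span hp)

theorem exists_testFunction_seq_of_mem_W012 (p : W012 Ω) :
    ∃ ζ : ℕ → Sp N → ℝ, (∀ n, IsTestFunction Ω (ζ n)) ∧
      Tendsto (fun n => eLpNorm (ζ n - (p.1.fst : Sp N → ℝ)) 2 (vol Ω)) atTop (𝓝 0) ∧
      Tendsto (fun n => eLpNorm (∇ (ζ n) - (p.1.snd : Sp N → Sp N)) 2 (vol Ω)) atTop (𝓝 0) := by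
  obtain ⟨q, hq, hlim⟩ := exists_seq_of_mem_topologicalClosure_span (G := testPairs Ω)
    ⟨0, IsTestFunction.zero, Lp.coeFn_zero _ _ _, by
      have : ∇ (0 : Sp N → ℝ) = 0 := by
        ext1 x; exact gradient_const x (0 : ℝ)
      rw [this]
      exact Lp.coeFn_zero _ _ _⟩
    (by
      rintro x ⟨ζ, hζ, h1, h2⟩ y ⟨ζ', hζ', h1', h2'⟩
      refine ⟨ζ + ζ', hζ.add hζ', (Lp.coeFn_add _ _).trans (h1.add h1'), ?_⟩
      rw [gradient_add (hζ.1.differentiable (by simp)) (hζ'.1.differentiable (by simp))]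
      exact (Lp.coeFn_add _ _).trans (h2.add h2'))
    (by
      rintro c x ⟨ζ, hζ, h1, h2⟩
      refine ⟨c • ζ, hζ.smul c, (Lp.coeFn_smul _ _).trans (h1.const_smul c), ?_⟩
      rw [gradient_smul (hζ.1.differentiable (by simp))]
      exact (Lp.coeFn_smul _ _).trans (h2.const_smul c))
    (p := p.1) p.2
  choose ζ hζ h1 h2 using hq
  exact ⟨ζ, hζ, tendsto_eLpNorm_of_tendsto_pair hlim h1 h2 EventuallyEq.rfl EventuallyEq.rfl⟩

theorem exists_represents_of_tendsto {ζ : ℕ → Sp N → ℝ} (hζ : ∀ n, IsTestFunction Ω (ζ n))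
    {u : Sp N → ℝ} {Du : Sp N → Sp N} (hu : MemLp u 2 (vol Ω)) (hDu : MemLp Du 2 (vol Ω))
    (h1 : Tendsto (fun n => eLpNorm (ζ n - u) 2 (vol Ω)) atTop (𝓝 0))
    (h2 : Tendsto (fun n => eLpNorm (∇ (ζ n) - Du) 2 (vol Ω)) atTop (𝓝 0)) :
    ∃ p : W012 Ω, Represents Ω p u Du := by
  have hlim := tendsto_toPair (fun n => (hζ n).memLp 2) (fun n => (hζ n).memLp_gradient 2)
    hu hDu h1 h2
  refine ⟨⟨toPair hu hDu, ?_⟩, coeFn_toPair_fst _ _, coeFn_toPair_snd _ _⟩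
  have hc : IsClosed (W012 Ω : Set (WithLp 2 (Lp ℝ 2 (vol Ω) × Lp (Sp N) 2 (vol Ω)))) := Submodule.isClosed_topologicalClosure _
  exact hc.mem_of_tendsto hlim (Eventually.of_forall fun n =>
    testPairs_subset_W012 (toPair_mem_testPairs (hζ n)))

theorem Represents.memLp {p : W012 Ω} {u : Sp N → ℝ} {Du : Sp N → Sp N}
    (h : Represents Ω p u Du) : MemLp u 2 (vol Ω) ∧ MemLp Du 2 (vol Ω) :=
  ⟨(memLp_congr_ae h.1).1 (Lp.memLp _), (memLp_congr_ae h.2).1 (Lp.memLp _)⟩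

theorem MemLp.comp_of_abs_deriv_le {X : Type*} [MeasurableSpace X] {μ : Measure X} {u : X → ℝ}
    (hu : MemLp u 2 μ) {S : ℝ → ℝ} (hS : ContDiff ℝ ∞ S) (hS0 : S 0 = 0) {C : ℝ}
    (hC : ∀ s, |deriv S s| ≤ C) : MemLp (S ∘ u) 2 μ := by
  refine (hu.const_mul C).mono (hS.continuous.comp_aestronglyMeasurable hu.1)
    (Eventually.of_forall fun x => ?_)
  have := abs_sub_le_of_abs_deriv_le (hS.differentiable (by simp)) hC (u x) 0
  simp only [hS0, sub_zero] at this
  simp only [Function.comp_apply, Real.norm_eq_abs, abs_mul]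
  exact this.trans (mul_le_mul_of_nonneg_right (le_abs_self C) (abs_nonneg _))

theorem MemLp.bounded_smul {X V : Type*} [MeasurableSpace X] [NormedAddCommGroup V]
    [NormedSpace ℝ V] {μ : Measure X} {c : X → ℝ} {F : X → V} {q : ℝ≥0∞} (hF : MemLp F q μ)
    (hc : AEStronglyMeasurable c μ) {C : ℝ} (hC : ∀ᵐ x ∂μ, |c x| ≤ C) :
    MemLp (fun x => c x • F x) q μ := by
  refine (hF.const_smul C).mono (hc.smul hF.1) ?_
  filter_upwards [hC] with x hx
  simp only [Pi.smul_apply, norm_smul, Real.norm_eq_abs]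
  exact mul_le_mul_of_nonneg_right (hx.trans (le_abs_self C)) (norm_nonneg _)

/-- `W_0^{1,2}(Ω)` is stable under composition with smooth Lipschitz functions vanishing at `0`. -/
theorem exists_represents_comp {p : W012 Ω} {u : Sp N → ℝ} {Du : Sp N → Sp N}
    (h : Represents Ω p u Du) {S : ℝ → ℝ} (hS : ContDiff ℝ ∞ S) (hS0 : S 0 = 0) {C : ℝ}
    (hC : ∀ s, |deriv S s| ≤ C) :
    ∃ q : W012 Ω, Represents Ω q (S ∘ u) (fun x => deriv S (u x) • Du x) := by
  obtain ⟨ζ, hζ, h1, h2⟩ := exists_testFunction_seq_of_mem_W012 p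
  obtain ⟨hu, hDu⟩ := h.memLp
  have h1' : Tendsto (fun n => eLpNorm (ζ n - u) 2 (vol Ω)) atTop (𝓝 0) :=
    h1.congr fun n => eLpNorm_congr_ae (EventuallyEq.rfl.sub h.1)
  have h2' : Tendsto (fun n => eLpNorm (∇ (ζ n) - Du) 2 (vol Ω)) atTop (𝓝 0) :=
    h2.congr fun n => eLpNorm_congr_ae (EventuallyEq.rfl.sub h.2)
  obtain ⟨ns, -, -, h3, h4⟩ := exists_subseq_comp_tendsto
    (fun n => ((hζ n).memLp 2).1) hu.1 (fun n => ((hζ n).memLp_gradient 2).1) hDu h1' h2' hS hC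
  refine exists_represents_of_tendsto (fun k => (hζ (ns k)).comp hS hS0)
    (MemLp.comp_of_abs_deriv_le hu hS hS0 hC)
    (MemLp.bounded_smul hDu ((hS.continuous_deriv (by simp)).comp_aestronglyMeasurable hu.1)
      (Eventually.of_forall fun x => hC _)) h3 ?_
  refine h4.congr fun k => ?_
  congr 2
  ext1 x
  exact (gradient_comp ((hζ (ns k)).1.differentiable (by simp) x)
    (hS.differentiable (by simp))).symm

theorem Represents.sub {p q : W012 Ω} {u u' : Sp N → ℝ} {Du Du' : Sp N → Sp N}
    (h : Represents Ω p u Du) (h' : Represents Ω q u' Du') :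
    Represents Ω (p - q) (u - u') (Du - Du') :=
  ⟨(Lp.coeFn_sub _ _).trans (h.1.sub h'.1), (Lp.coeFn_sub _ _).trans (h.2.sub h'.2)⟩

theorem Represents.smul {p : W012 Ω} {u : Sp N → ℝ} {Du : Sp N → Sp N} (c : ℝ)
    (h : Represents Ω p u Du) : Represents Ω (c • p) (c • u) (c • Du) :=
  ⟨(Lp.coeFn_smul _ _).trans (h.1.const_smul c), (Lp.coeFn_smul _ _).trans (h.2.const_smul c)⟩

theorem MemL2W012.sub {u u' : Sp N × ℝ → ℝ} {Du Du' : Sp N × ℝ → Sp N}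
    (h : MemL2W012 Ω T u Du) (h' : MemL2W012 Ω T u' Du') :
    MemL2W012 Ω T (u - u') (Du - Du') := by
  refine ⟨h.1.sub h'.1, h.2.1.sub h'.2.1, ?_⟩
  filter_upwards [h.2.2, h'.2.2] with t ⟨p, hp⟩ ⟨q, hq⟩
  exact ⟨p - q, hp.sub hq⟩

theorem MemL2W012.comp {u : Sp N × ℝ → ℝ} {Du : Sp N × ℝ → Sp N} (h : MemL2W012 Ω T u Du)
    {S : ℝ → ℝ} (hS : ContDiff ℝ ∞ S) (hS0 : S 0 = 0) {C : ℝ} (hC : ∀ s, |deriv S s| ≤ C) :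
    MemL2W012 Ω T (S ∘ u) (fun p => deriv S (u p) • Du p) := by
  refine ⟨MemLp.comp_of_abs_deriv_le h.1 hS hS0 hC, MemLp.bounded_smul h.2.1
    ((hS.continuous_deriv (by simp)).comp_aestronglyMeasurable h.1.1)
    (Eventually.of_forall fun x => hC _), ?_⟩
  filter_upwards [h.2.2] with t ⟨p, hp⟩
  exact exists_represents_comp hp hS hS0 hC

theorem MemL2W012.time_smul {u : Sp N × ℝ → ℝ} {Du : Sp N × ℝ → Sp N} (h : MemL2W012 Ω T u Du)
    {χ : ℝ → ℝ} (hχ : Continuous χ) {C : ℝ} (hC : ∀ t ∈ Ioo 0 T, |χ t| ≤ C)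
    (hΩ : MeasurableSet Ω) :
    MemL2W012 Ω T (fun p => χ p.2 * u p) (fun p => χ p.2 • Du p) := by
  have hm : AEStronglyMeasurable (fun p : Sp N × ℝ => χ p.2) (volume.restrict (cylinder Ω T)) :=
    (hχ.comp continuous_snd).aestronglyMeasurable
  have hb : ∀ᵐ p ∂(volume.restrict (cylinder Ω T)), |χ p.2| ≤ C :=
    (ae_restrict_iff' (hΩ.prod measurableSet_Ioo)).2 (Eventually.of_forall fun p hp => hC _ hp.2)
  refine ⟨MemLp.bounded_smul h.1 hm hb, MemLp.bounded_smul h.2.1 hm hb, ?_⟩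
  filter_upwards [h.2.2] with t ⟨p, hp⟩
  exact ⟨χ t • p, hp.smul (χ t)⟩

theorem IsTestFunction.slice {ψ : Sp N × ℝ → ℝ} {I : Set ℝ} (hψ : IsTestFunction (Ω ×ˢ I) ψ)
    (t : ℝ) : IsTestFunction Ω (fun x => ψ (x, t)) := by
  have hsub : tsupport (fun x => ψ (x, t)) ⊆ (fun x => (x, t)) ⁻¹' tsupport ψ :=
    closure_minimal (fun x hx => subset_tsupport ψ hx)
      ((isClosed_tsupport ψ).preimage (by fun_prop))
  refine ⟨hψ.1.comp (contDiff_prodMk_left t), ?_, fun x hx => (hψ.2.2 (hsub hx)).1⟩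
  refine IsCompact.of_isClosed_subset (hψ.2.1.isCompact.image continuous_fst)
    (isClosed_tsupport _) fun x hx => ⟨(x, t), hsub hx, rfl⟩

theorem IsTestFunction.memL2W012 {ψ : Sp N × ℝ → ℝ} {I : Set ℝ}
    (hψ : IsTestFunction (Ω ×ˢ I) ψ) : MemL2W012 Ω T ψ (spaceGrad ψ) :=
  ⟨hψ.memLp 2, hψ.memLp_spaceGrad 2, Eventually.of_forall fun t =>
    ⟨⟨_, testPairs_subset_W012 (toPair_mem_testPairs (hψ.slice t))⟩,
      coeFn_toPair_fst _ _, coeFn_toPair_snd _ _⟩⟩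

end Sobolev

/-! ### Density of test functions on the cylinder -/

section Density

variable {N : ℕ} {Ω : Set (Sp N)} {T : ℝ}

theorem IsTestFunction.mul_prod {ζ : Sp N → ℝ} {g : ℝ → ℝ} {I : Set ℝ}
    (hζ : IsTestFunction Ω ζ) (hg : IsTestFunction I g) :
    IsTestFunction (Ω ×ˢ I) (fun p : Sp N × ℝ => ζ p.1 * g p.2) := by
  have hsub : tsupport (fun p : Sp N × ℝ => ζ p.1 * g p.2) ⊆ tsupport ζ ×ˢ tsupport g := by
    refine closure_minimal (fun p hp => ?_) ((isClosed_tsupport ζ).prod (isClosed_tsupport g))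
    exact ⟨subset_tsupport ζ (left_ne_zero_of_mul hp), subset_tsupport g (right_ne_zero_of_mul hp)⟩
  exact ⟨(hζ.1.comp contDiff_fst).mul (hg.1.comp contDiff_snd),
    (hζ.2.1.isCompact.prod hg.2.1.isCompact).of_isClosed_subset (isClosed_tsupport _) hsub,
    hsub.trans (prod_mono hζ.2.2 hg.2.2)⟩

theorem spaceGrad_mul_prod {ζ : Sp N → ℝ} (hζ : Differentiable ℝ ζ) (g : ℝ → ℝ)
    (p : Sp N × ℝ) : spaceGrad (fun p : Sp N × ℝ => ζ p.1 * g p.2) p = g p.2 • ∇ ζ p.1 := by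
  have : (fun y => ζ y * g p.2) = g p.2 • ζ := by
    ext y; simp [mul_comm]
  simp only [spaceGrad]
  rw [this, gradient_smul hζ]
  rfl

/-- Testing with the products `ζ(x) g(t)` reduces the claim to the fundamental lemma of the calculus
of variations in `t`. The exceptional null set depends on `ζ`. -/
theorem ae_integral_slice_eq_zero {a : Sp N × ℝ → ℝ} {b : Sp N × ℝ → Sp N}
    (ha : MemLp a 2 (volume.restrict (cylinder Ω T)))
    (hb : MemLp b 2 (volume.restrict (cylinder Ω T)))
    (h : ∀ ψ, IsTestFunction (cylinder Ω T) ψ →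
      (∫ p in cylinder Ω T, a p * ψ p) + ∫ p in cylinder Ω T, inner ℝ (b p) (spaceGrad ψ p) = 0)
    {ζ : Sp N → ℝ} (hζ : IsTestFunction Ω ζ) :
    ∀ᵐ t ∂(volume.restrict (Ioo 0 T)),
      ∫ x in Ω, (a (x, t) * ζ x + inner ℝ (b (x, t)) (∇ ζ x)) = 0 := by
  rw [volume_restrict_cylinder] at ha hb h
  have hζ1 : MemLp (fun p : Sp N × ℝ => ζ p.1) 2 ((vol Ω).prod (volume.restrict (Ioo 0 T))) :=
    MemLp.comp_fst (hζ.memLp 2) _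
  have hζ2 : MemLp (fun p : Sp N × ℝ => ∇ ζ p.1) 2 ((vol Ω).prod (volume.restrict (Ioo 0 T))) :=
    MemLp.comp_fst (hζ.memLp_gradient 2) _
  have hi := (MemLp.integrable_mul_two ha hζ1).add (MemLp.integrable_inner_two hb hζ2)
  have hm := hi.integral_prod_right
  have key := isOpen_Ioo.ae_eq_zero_of_integral_contDiff_smul_eq_zero
    (hm.locallyIntegrable.locallyIntegrableOn (Ioo 0 T)) (fun g h1 h2 h3 => by
      have hg : IsTestFunction (Ioo 0 T) g := ⟨h1, h2, h3⟩
      have hψ := hζ.mul_prod hg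
      have h0 := h _ hψ
      have e1 := MemLp.integrable_mul_two ha
        (hψ.memLp (μ := (vol Ω).prod (volume.restrict (Ioo 0 T))) 2)
      have e2 := MemLp.integrable_inner_two hb
        (hψ.memLp_spaceGrad (μ := (vol Ω).prod (volume.restrict (Ioo 0 T))) 2)
      have e3 : Integrable (fun p : Sp N × ℝ => a p * (ζ p.1 * g p.2) +
          inner ℝ (b p) (spaceGrad (fun p : Sp N × ℝ => ζ p.1 * g p.2) p))
          ((vol Ω).prod (volume.restrict (Ioo 0 T))) := e1.add e2
      rw [← integral_add e1 e2, integral_prod_symm _ e3] at h0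
      refine Eq.trans ?_ h0
      refine integral_congr_ae (Eventually.of_forall fun t => ?_)
      simp only [smul_eq_mul, Pi.add_apply]
      rw [← integral_const_mul]
      refine integral_congr_ae (Eventually.of_forall fun x => ?_)
      simp only
      rw [spaceGrad_mul_prod (hζ.1.differentiable (by simp)), inner_smul_right]
      ring)
  filter_upwards [key, ae_restrict_mem measurableSet_Ioo] with t ht htm
  exact ht htm

/-- For almost every `t` the slice of `(a, b)` is orthogonal to all test pairs, hence to their
closure `W012 Ω`, hence to the slice of `φ`. Integration in `t` concludes. -/
theorem integral_eq_zero_of_orthogonal_testFunctions {a : Sp N × ℝ → ℝ} {b : Sp N × ℝ → Sp N}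
    (ha : MemLp a 2 (volume.restrict (cylinder Ω T)))
    (hb : MemLp b 2 (volume.restrict (cylinder Ω T)))
    (h : ∀ ψ, IsTestFunction (cylinder Ω T) ψ →
      (∫ p in cylinder Ω T, a p * ψ p) + ∫ p in cylinder Ω T, inner ℝ (b p) (spaceGrad ψ p) = 0)
    {φ : Sp N × ℝ → ℝ} {Dφ : Sp N × ℝ → Sp N} (hφ : MemL2W012 Ω T φ Dφ) :
    (∫ p in cylinder Ω T, a p * φ p) + ∫ p in cylinder Ω T, inner ℝ (b p) (Dφ p) = 0 := by
  have : Fact ((2 : ℝ≥0∞) ≠ ⊤) := ⟨by simp⟩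
  have : SecondCountableTopology (Lp ℝ 2 (vol Ω)) := Lp.SecondCountableTopology
  have : SecondCountableTopology (Lp (Sp N) 2 (vol Ω)) := Lp.SecondCountableTopology
  have : SecondCountableTopology (WithLp 2 (Lp ℝ 2 (vol Ω) × Lp (Sp N) 2 (vol Ω))) :=
    WithLp.secondCountableTopology 2 _ _
  -- A countable dense set of test pairs, available by separability of `L² × L²`, allows one null
  -- set of times to serve all of them.
  obtain ⟨D, hDsub, hDc, hDd⟩ := (TopologicalSpace.IsSeparable.of_separableSpace
    (testPairs Ω)).exists_countable_dense_subset
  have h1 : ∀ᵐ t ∂(volume.restrict (Ioo 0 T)), ∀ d ∈ D,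
      ∫ x in Ω, (a (x, t) * d.fst x + inner ℝ (b (x, t)) (d.snd x)) = 0 := by
    refine (ae_ball_iff hDc).2 fun d hd => ?_
    obtain ⟨ζ, hζ, e1, e2⟩ := hDsub hd
    filter_upwards [ae_integral_slice_eq_zero ha hb h hζ] with t ht
    rw [← ht]
    refine integral_congr_ae ?_
    filter_upwards [e1, e2] with x hx1 hx2
    rw [hx1, hx2]
  have i1 := MemLp.integrable_mul_two ha hφ.1
  have i2 := MemLp.integrable_inner_two hb hφ.2.1
  have ha' := ha
  have hb' := hb
  rw [volume_restrict_cylinder] at i1 i2 ha' hb' ⊢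
  have i3 : Integrable (fun p => a p * φ p + inner ℝ (b p) (Dφ p))
      ((vol Ω).prod (volume.restrict (Ioo 0 T))) := i1.add i2
  rw [← integral_add i1 i2, integral_prod_symm _ i3]
  have slice : ∀ {E : Type} [NormedAddCommGroup E] {c : Sp N × ℝ → E},
      MemLp c 2 ((vol Ω).prod (volume.restrict (Ioo 0 T))) →
      ∀ᵐ t ∂(volume.restrict (Ioo 0 T)), MemLp (fun x => c (x, t)) 2 (vol Ω) := by
    intro E _ c hc
    have hfin : ∫⁻ t in Ioo 0 T, eLpNorm (fun x => c (x, t)) 2 (vol Ω) ^ 2 ≠ ⊤ := by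
      rw [lintegral_eLpNorm_two_sq hc.1]
      exact (ENNReal.pow_lt_top hc.2).ne
    filter_upwards [hc.1.prodMk_right,
      ae_lt_top' (aemeasurable_eLpNorm_two_sq hc.1) hfin] with t ht1 ht2
    refine ⟨ht1, ?_⟩
    by_contra hcon
    rw [not_lt, top_le_iff] at hcon
    rw [hcon] at ht2
    simp at ht2
  refine integral_eq_zero_of_ae ?_
  filter_upwards [h1, slice ha', slice hb', hφ.2.2] with t ht hat hbt ⟨p, hp⟩
  have hinner : ∀ q : WithLp 2 (Lp ℝ 2 (vol Ω) × Lp (Sp N) 2 (vol Ω)),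
      inner ℝ (toPair hat hbt) q =
        ∫ x in Ω, (a (x, t) * q.fst x + inner ℝ (b (x, t)) (q.snd x)) := by
    intro q
    rw [WithLp.prod_inner_apply, L2.inner_def, L2.inner_def,
      integral_add (MemLp.integrable_mul_two hat (Lp.memLp q.fst))
        (MemLp.integrable_inner_two hbt (Lp.memLp q.snd))]
    congr 1
    · refine integral_congr_ae ?_
      filter_upwards [coeFn_toPair_fst hat hbt] with x hx
      have hx' : ((toPair hat hbt).ofLp.1 : Sp N → ℝ) x = a (x, t) := hx
      rw [hx']
      exact mul_comm _ _
    · refine integral_congr_ae ?_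
      filter_upwards [coeFn_toPair_snd hat hbt] with x hx
      have hx' : ((toPair hat hbt).ofLp.2 : Sp N → Sp N) x = b (x, t) := hx
      rw [hx']
      rfl
  have hperp : ∀ q ∈ W012 Ω, inner ℝ (toPair hat hbt) q = 0 := by
    have hcl : IsClosed {q : WithLp 2 (Lp ℝ 2 (vol Ω) × Lp (Sp N) 2 (vol Ω)) |
        inner ℝ (toPair hat hbt) q = 0} :=
      isClosed_eq (continuous_const.inner continuous_id) continuous_const
    have hG : testPairs Ω ⊆ {q | inner ℝ (toPair hat hbt) q = 0} :=
      hDd.trans (closure_minimal (fun d hd => (hinner d).trans (ht d hd)) hcl)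
    have hspan : (Submodule.span ℝ (testPairs Ω)) ≤
        LinearMap.ker (innerSL ℝ (toPair hat hbt)).toLinearMap :=
      Submodule.span_le.2 fun q hq => hG hq
    intro q hq
    exact closure_minimal (fun q hq => hspan hq) hcl hq
  have hz := (hinner p.1).symm.trans (hperp p.1 p.2)
  simp only [Pi.zero_apply]
  rw [← hz]
  refine integral_congr_ae ?_
  filter_upwards [hp.1, hp.2] with x hx1 hx2
  rw [hx1, hx2]

/-- Functions in `L²(0,T; W_0^{1,2}(Ω))` are limits of test functions on `Q`. -/
theorem MemL2W012.exists_testFunction_seq {φ : Sp N × ℝ → ℝ} {Dφ : Sp N × ℝ → Sp N}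
    (hφ : MemL2W012 Ω T φ Dφ) :
    ∃ ψ : ℕ → Sp N × ℝ → ℝ, (∀ n, IsTestFunction (cylinder Ω T) (ψ n)) ∧
      Tendsto (fun n => eLpNorm (ψ n - φ) 2 (volume.restrict (cylinder Ω T))) atTop (𝓝 0) ∧
      Tendsto (fun n => eLpNorm (spaceGrad (ψ n) - Dφ) 2 (volume.restrict (cylinder Ω T)))
        atTop (𝓝 0) := by
  set μ := volume.restrict (cylinder Ω T) with hμ
  set G : Set (WithLp 2 (Lp ℝ 2 μ × Lp (Sp N) 2 μ)) := {p | ∃ ψ : Sp N × ℝ → ℝ,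
    IsTestFunction (cylinder Ω T) ψ ∧ (p.fst : Sp N × ℝ → ℝ) =ᵐ[μ] ψ ∧
      (p.snd : Sp N × ℝ → Sp N) =ᵐ[μ] spaceGrad ψ} with hG
  have hmem : toPair hφ.1 hφ.2.1 ∈ (Submodule.span ℝ G).topologicalClosure := by
    -- In a Hilbert space the closure is the double orthogonal complement, so it suffices that every
    -- `y` orthogonal to the test functions is orthogonal to `φ`.
    rw [← Submodule.orthogonal_orthogonal_eq_closure, Submodule.mem_orthogonal]
    intro y hy
    have hinner : ∀ {u : Sp N × ℝ → ℝ} {Du : Sp N × ℝ → Sp N} (hu : MemLp u 2 μ)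
        (hDu : MemLp Du 2 μ), inner ℝ y (toPair hu hDu) =
          (∫ p, y.fst p * u p ∂μ) + ∫ p, inner ℝ (y.snd p) (Du p) ∂μ := by
      intro u Du hu hDu
      rw [WithLp.prod_inner_apply, L2.inner_def, L2.inner_def]
      congr 1
      · refine integral_congr_ae ?_
        filter_upwards [coeFn_toPair_fst hu hDu] with x hx
        have hx' : ((toPair hu hDu).ofLp.1 : Sp N × ℝ → ℝ) x = u x := hx
        rw [hx']
        exact mul_comm _ _
      · refine integral_congr_ae ?_
        filter_upwards [coeFn_toPair_snd hu hDu] with x hx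
        have hx' : ((toPair hu hDu).ofLp.2 : Sp N × ℝ → Sp N) x = Du x := hx
        rw [hx']
        rfl
    rw [hinner]
    refine integral_eq_zero_of_orthogonal_testFunctions (Lp.memLp y.fst) (Lp.memLp y.snd)
      (fun ψ hψ => ?_) hφ
    rw [← hinner (hψ.memLp 2) (hψ.memLp_spaceGrad 2)]
    exact (Submodule.mem_orthogonal' _ _).1 hy _ (Submodule.subset_span
      ⟨ψ, hψ, coeFn_toPair_fst _ _, coeFn_toPair_snd _ _⟩)
  obtain ⟨q, hq, hlim⟩ := exists_seq_of_mem_topologicalClosure_span (G := G)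
    ⟨0, IsTestFunction.zero, Lp.coeFn_zero _ _ _, by
      have : spaceGrad (0 : Sp N × ℝ → ℝ) = 0 := by
        ext1 x; exact gradient_const x.1 (0 : ℝ)
      rw [this]
      exact Lp.coeFn_zero _ _ _⟩
    (by
      rintro x ⟨ζ, hζ, h1, h2⟩ y ⟨ζ', hζ', h1', h2'⟩
      refine ⟨ζ + ζ', hζ.add hζ', (Lp.coeFn_add _ _).trans (h1.add h1'), ?_⟩
      rw [spaceGrad_add (hζ.1.differentiable (by simp)) (hζ'.1.differentiable (by simp))]
      exact (Lp.coeFn_add _ _).trans (h2.add h2'))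
    (by
      rintro c x ⟨ζ, hζ, h1, h2⟩
      refine ⟨c • ζ, hζ.smul c, (Lp.coeFn_smul _ _).trans (h1.const_smul c), ?_⟩
      rw [spaceGrad_smul (hζ.1.differentiable (by simp))]
      exact (Lp.coeFn_smul _ _).trans (h2.const_smul c))
    hmem
  choose ψ hψ h1 h2 using hq
  exact ⟨ψ, hψ, tendsto_eLpNorm_of_tendsto_pair hlim h1 h2 (coeFn_toPair_fst _ _)
    (coeFn_toPair_snd _ _)⟩

theorem exists_smooth_truncation (K : ℝ) : ∃ (S : ℝ → ℝ) (C : ℝ), ContDiff ℝ ∞ S ∧ S 0 = 0 ∧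
    (∀ s, |S s| ≤ C) ∧ (∀ s, |deriv S s| ≤ C) ∧ ∀ s, |s| ≤ K → S s = s ∧ deriv S s = 1 := by
  -- The inner radius exceeds `|K|`, so `s ρ(s)` is the identity in a neighbourhood of each `s` with
  -- `|s| ≤ K`, endpoints included. This is what gives derivative 1 there.
  let ρ : ContDiffBump (0 : ℝ) := ⟨|K| + 1, |K| + 2, by positivity, by linarith⟩
  have hS : ContDiff ℝ ∞ fun s => s * ρ s := contDiff_id.mul ρ.contDiff
  have hc : HasCompactSupport fun s => s * ρ s := ρ.hasCompactSupport.mul_left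
  obtain ⟨C₁, hC₁⟩ := hS.continuous.bounded_above_of_compact_support hc
  obtain ⟨C₂, hC₂⟩ := (hS.continuous_deriv (by simp)).bounded_above_of_compact_support hc.deriv
  refine ⟨_, max C₁ C₂, hS, by simp, fun s => (hC₁ s).trans (le_max_left _ _),
    fun s => (hC₂ s).trans (le_max_right _ _), fun s hs => ?_⟩
  have hev : (fun s => s * ρ s) =ᶠ[𝓝 s] fun s => s := by
    have : Metric.ball (0 : ℝ) (|K| + 1) ∈ 𝓝 s := Metric.isOpen_ball.mem_nhds (by
      rw [mem_ball_zero_iff, Real.norm_eq_abs]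
      linarith [le_abs_self K])
    filter_upwards [this] with r hr
    rw [ρ.one_of_mem_closedBall (Metric.ball_subset_closedBall hr), mul_one]
  exact ⟨hev.eq_of_nhds, by rw [hev.deriv_eq]; simp⟩

/-- Bounded functions in `L²(0,T; W_0^{1,2}(Ω))` are limits of uniformly bounded test functions. -/
theorem MemL2W012.exists_bounded_testFunction_seq {φ : Sp N × ℝ → ℝ} {Dφ : Sp N × ℝ → Sp N}
    (hφ : MemL2W012 Ω T φ Dφ) {K : ℝ}
    (hK : ∀ᵐ p ∂(volume.restrict (cylinder Ω T)), |φ p| ≤ K) :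
    ∃ (ψ : ℕ → Sp N × ℝ → ℝ) (C : ℝ), (∀ n, IsTestFunction (cylinder Ω T) (ψ n)) ∧
      (∀ n p, |ψ n p| ≤ C) ∧
      (∀ᵐ p ∂(volume.restrict (cylinder Ω T)), Tendsto (fun n => ψ n p) atTop (𝓝 (φ p))) ∧
      Tendsto (fun n => eLpNorm (spaceGrad (ψ n) - Dφ) 2 (volume.restrict (cylinder Ω T)))
        atTop (𝓝 0) := by
  obtain ⟨ψ, hψ, h1, h2⟩ := hφ.exists_testFunction_seq
  -- Composition with `S` bounds the approximations uniformly and leaves the limit unchanged,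
  -- because `|φ| ≤ K` almost everywhere.
  obtain ⟨S, C, hS, hS0, hC, hC', hSK⟩ := exists_smooth_truncation K
  obtain ⟨ns, -, h3, -, h5⟩ := exists_subseq_comp_tendsto (fun n => ((hψ n).memLp 2).1) hφ.1.1
    (fun n => ((hψ n).memLp_spaceGrad 2).1) hφ.2.1 h1 h2 hS hC'
  refine ⟨fun k => S ∘ ψ (ns k), C, fun k => (hψ (ns k)).comp hS hS0, fun k p => hC _, ?_, ?_⟩
  · filter_upwards [h3, hK] with p hp hpK
    have := (hS.continuous.tendsto _).comp hp
    rwa [(hSK _ hpK).1] at this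
  · refine h5.congr fun k => ?_
    refine eLpNorm_congr_ae (EventuallyEq.sub ?_ ?_)
    · rw [spaceGrad_comp ((hψ (ns k)).1.differentiable (by simp)) (hS.differentiable (by simp))]
    · filter_upwards [hK] with p hp
      rw [(hSK _ hp).2, one_smul]

end Density

/-! ### Translations in time -/

section Shift

variable {N : ℕ} {Ω : Set (Sp N)} {T : ℝ}

/-- Translation in time. -/
def timeShift (N : ℕ) (r : ℝ) : C(Sp N × ℝ, Sp N × ℝ) := ⟨fun p => (p.1, p.2 + r), by fun_prop⟩

theorem timeShift_apply (r : ℝ) (p : Sp N × ℝ) : timeShift N r p = (p.1, p.2 + r) := rfl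

theorem measurePreserving_timeShift (N : ℕ) (r : ℝ) :
    MeasurePreserving (timeShift N r) volume volume :=
  (MeasurePreserving.id volume).prod (measurePreserving_add_right volume r)

theorem continuous_timeShift (N : ℕ) : Continuous (timeShift N) := by
  have h : Continuous fun q : ℝ × (Sp N × ℝ) => (q.2.1, q.2.2 + q.1) := by fun_prop
  exact (ContinuousMap.curry ⟨_, h⟩).continuous

theorem timeShift_neg_apply (r : ℝ) (p : Sp N × ℝ) : timeShift N r (timeShift N (-r) p) = p := by
  simp [timeShift_apply]

theorem integral_comp_timeShift (r : ℝ) (u : Sp N × ℝ → ℝ) :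
    ∫ p, u (timeShift N r p) = ∫ p, u p := by
  refine (measurePreserving_timeShift N r).integral_comp ?_ u
  have : (timeShift N r : Sp N × ℝ → Sp N × ℝ) =
      (Homeomorph.refl (Sp N)).prodCongr (Homeomorph.addRight r) := rfl
  rw [this]
  exact (Homeomorph.measurableEmbedding _)

/-- Translation in time on `L^q`. -/
def shiftLp {E : Type*} [NormedAddCommGroup E] {q : ℝ≥0∞} (r : ℝ)
    (F : Lp E q (volume : Measure (Sp N × ℝ))) : Lp E q (volume : Measure (Sp N × ℝ)) :=
  Lp.compMeasurePreserving (timeShift N r) (measurePreserving_timeShift N r) F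

theorem coeFn_shiftLp {E : Type*} [NormedAddCommGroup E] {q : ℝ≥0∞} (r : ℝ)
    (F : Lp E q (volume : Measure (Sp N × ℝ))) :
    (shiftLp r F : Sp N × ℝ → E) =ᵐ[volume] fun p => F (timeShift N r p) :=
  Lp.coeFn_compMeasurePreserving _ _

theorem continuous_shiftLp {E : Type*} [NormedAddCommGroup E] {q : ℝ≥0∞} [Fact (1 ≤ q)]
    (hq : q ≠ ⊤) : Continuous fun x : ℝ × Lp E q (volume : Measure (Sp N × ℝ)) =>
      shiftLp x.1 x.2 :=
  Continuous.compMeasurePreservingLp continuous_snd ((continuous_timeShift N).comp continuous_fst)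
    (fun x => measurePreserving_timeShift N x.1) hq

theorem continuous_integral_inner_timeShift {b F : Sp N × ℝ → Sp N} (hb : MemLp b 2)
    (hF : MemLp F 2) : Continuous fun r => ∫ p, inner ℝ (b p) (F (timeShift N r p)) := by
  have h : Continuous fun r : ℝ => inner ℝ (hb.toLp b) (shiftLp r (hF.toLp F)) :=
    continuous_const.inner ((continuous_shiftLp (by simp)).comp
      (continuous_id.prodMk continuous_const))
  refine h.congr fun r => ?_
  rw [L2.inner_def]
  refine integral_congr_ae ?_
  filter_upwards [hb.coeFn_toLp, coeFn_shiftLp r (hF.toLp F),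
    (measurePreserving_timeShift N r).quasiMeasurePreserving.ae_eq_comp hF.coeFn_toLp]
    with p h1 h2 h3
  rw [h1, h2]
  exact congrArg _ h3

theorem norm_integral_inner_timeShift_le {b F : Sp N × ℝ → Sp N} (hb : MemLp b 2)
    (hF : MemLp F 2) (r : ℝ) : |∫ p, inner ℝ (b p) (F (timeShift N r p))| ≤
      (eLpNorm b 2 volume).toReal * (eLpNorm F 2 volume).toReal := by
  have hF' := hF.comp_measurePreserving (measurePreserving_timeShift N r)
  have e : ∫ p, inner ℝ (b p) (F (timeShift N r p)) = inner ℝ (hb.toLp b) (hF'.toLp _) := by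
    rw [L2.inner_def]
    refine integral_congr_ae ?_
    filter_upwards [hb.coeFn_toLp, hF'.coeFn_toLp] with p h1 h2
    rw [h1, h2]
    rfl
  rw [e]
  refine (abs_real_inner_le_norm _ _).trans (le_of_eq ?_)
  rw [Lp.norm_toLp, Lp.norm_toLp,
    eLpNorm_comp_measurePreserving hF.1 (measurePreserving_timeShift N r)]

theorem integrable_mul_of_abs_le {X : Type*} [MeasurableSpace X] {μ : Measure X} {g φ : X → ℝ}
    (hg : Integrable g μ) (hφ : AEStronglyMeasurable φ μ) {C : ℝ} (hC : ∀ᵐ p ∂μ, |φ p| ≤ C) :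
    Integrable (fun p => g p * φ p) μ :=
  hg.mul_bdd hφ hC

/-- Translation is not continuous on `L^∞`, so a change of variables moves it from the bounded
factor `φ` to `g`, where continuity of translations in `L¹` applies. -/
theorem continuous_integral_mul_timeShift {g φ : Sp N × ℝ → ℝ} (hg : Integrable g)
    (hφ : AEStronglyMeasurable φ) {C : ℝ} (hC : ∀ᵐ p, |φ p| ≤ C) :
    Continuous fun r => ∫ p, g p * φ (timeShift N r p) := by
  have hg' : MemLp g 1 := memLp_one_iff_integrable.2 hg
  have h : Continuous fun r : ℝ => shiftLp (-r) (hg'.toLp g) :=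
    (continuous_shiftLp (by simp)).comp (continuous_neg.prodMk continuous_const)
  have hL : Continuous fun G : Lp ℝ 1 (volume : Measure (Sp N × ℝ)) => ∫ p, G p * φ p := by
    refine (LipschitzWith.of_dist_le_mul (K := C.toNNReal) fun G G' => ?_).continuous
    have i := fun G : Lp ℝ 1 (volume : Measure (Sp N × ℝ)) =>
      integrable_mul_of_abs_le (L1.integrable_coeFn G) hφ hC
    rw [dist_eq_norm, dist_eq_norm, ← integral_sub (i G) (i G'), L1.norm_eq_integral_norm,
      ← integral_const_mul]
    refine norm_integral_le_of_norm_le ((L1.integrable_coeFn (G - G')).norm.const_mul _) ?_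
    filter_upwards [hC, Lp.coeFn_sub G G'] with p hp hs
    rw [hs, ← sub_mul, norm_mul, mul_comm]
    simp only [Pi.sub_apply]
    gcongr
    exact hp.trans (Real.le_coe_toNNReal C)
  refine (hL.comp h).congr fun r => ?_
  rw [← integral_comp_timeShift (-r) (fun p => g p * φ (timeShift N r p))]
  refine integral_congr_ae ?_
  filter_upwards [coeFn_shiftLp (-r) (hg'.toLp g),
    (measurePreserving_timeShift N (-r)).quasiMeasurePreserving.ae_eq_comp hg'.coeFn_toLp]
    with p h2 h3
  rw [h2, timeShift_neg_apply]
  congr 1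

end Shift

/-! ### From the time derivative to a finite difference -/

section ShiftedIdentity

variable {N : ℕ} {Ω : Set (Sp N)} {T : ℝ}

theorem timeDeriv_eq {ψ : Sp N × ℝ → ℝ} (hψ : Differentiable ℝ ψ) :
    timeDeriv ψ = fun p => fderiv ℝ ψ p (0, 1) := by
  ext1 p
  have h1 : HasDerivAt (fun s : ℝ => (p.1, s)) ((0 : Sp N), (1 : ℝ)) p.2 :=
    (hasDerivAt_const p.2 p.1).prodMk (hasDerivAt_id p.2)
  exact ((hψ p).hasFDerivAt.comp_hasDerivAt p.2 h1).deriv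

theorem hasDerivAt_timeShift {ψ : Sp N × ℝ → ℝ} (hψ : Differentiable ℝ ψ) (p : Sp N × ℝ) (r : ℝ) :
    HasDerivAt (fun s => ψ (timeShift N s p)) (timeDeriv ψ (timeShift N r p)) r := by
  have h1 : HasDerivAt (fun s : ℝ => timeShift N s p) ((0 : Sp N), (1 : ℝ)) r :=
    (hasDerivAt_const r p.1).prodMk ((hasDerivAt_id r).const_add p.2)
  rw [timeDeriv_eq hψ]
  exact (hψ _).hasFDerivAt.comp_hasDerivAt r h1

theorem continuous_timeDeriv {ψ : Sp N × ℝ → ℝ} (hψ : ContDiff ℝ ∞ ψ) :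
    Continuous (timeDeriv ψ) := by
  rw [timeDeriv_eq (hψ.differentiable (by simp))]
  exact (hψ.continuous_fderiv (by simp)).clm_apply continuous_const

theorem exists_abs_timeDeriv_le {ψ : Sp N × ℝ → ℝ} (hψ : ContDiff ℝ ∞ ψ)
    (hc : HasCompactSupport ψ) : ∃ C, ∀ p, |timeDeriv ψ p| ≤ C := by
  refine (continuous_timeDeriv hψ).bounded_above_of_compact_support ?_
  rw [timeDeriv_eq (hψ.differentiable (by simp))]
  exact (hc.fderiv ℝ).comp_left (g := fun L : (Sp N × ℝ) →L[ℝ] ℝ => L (0, 1)) (by simp)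

theorem timeDeriv_timeShift (ψ : Sp N × ℝ → ℝ) (r : ℝ) (p : Sp N × ℝ) :
    timeDeriv (fun q => ψ (timeShift N r q)) p = timeDeriv ψ (timeShift N r p) :=
  deriv_comp_add_const (fun s => ψ (p.1, s)) r p.2

/-- A shift by `r ≥ 0` moves the support towards earlier times. It may cross `t = 0` but stays below
`T`, which is exactly what the weak formulation with initial value allows. -/
theorem IsTestFunction.timeShift {ψ : Sp N × ℝ → ℝ} (hψ : IsTestFunction (cylinder Ω T) ψ)
    {r : ℝ} (hr : 0 ≤ r) :
    IsTestFunction (Ω ×ˢ Iio T) (fun p => ψ (ParabolicComparison.timeShift N r p)) := by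
  have hsub : tsupport (fun p => ψ (ParabolicComparison.timeShift N r p)) ⊆
      ParabolicComparison.timeShift N r ⁻¹' tsupport ψ :=
    closure_minimal (fun x hx => subset_tsupport ψ hx)
      ((isClosed_tsupport ψ).preimage (ContinuousMap.continuous _))
  refine ⟨hψ.1.comp (contDiff_fst.prodMk (contDiff_snd.add contDiff_const)), ?_, fun p hp => ?_⟩
  · refine IsCompact.of_isClosed_subset (hψ.2.1.isCompact.image
      (ParabolicComparison.timeShift N (-r)).continuous) (isClosed_tsupport _)
      fun p hp => ⟨_, hsub hp, ?_⟩
    simp [timeShift_apply]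
  · have h := hψ.2.2 (hsub hp)
    refine ⟨h.1, ?_⟩
    have h2 : p.2 + r < T := h.2.2
    rw [mem_Iio]
    linarith

/-- The time derivative of `z` is `g - div b`, and the initial value is `z₀`. -/
def HasWeakTimeDeriv (Ω : Set (Sp N)) (T : ℝ) (z g : Sp N × ℝ → ℝ) (b : Sp N × ℝ → Sp N)
    (z₀ : Sp N → ℝ) : Prop :=
  ∀ ψ : Sp N × ℝ → ℝ, IsTestFunction (Ω ×ˢ Iio T) ψ →
    -(∫ p in cylinder Ω T, z p * timeDeriv ψ p) - ∫ x in Ω, z₀ x * ψ (x, 0) =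
      (∫ p in cylinder Ω T, g p * ψ p) + ∫ p in cylinder Ω T, inner ℝ (b p) (spaceGrad ψ p)

/-- Test with `ψ(x, t + r)` and integrate over `r ∈ (0, τ]`. The resulting identity contains no time
derivative of `ψ`, so it can pass to functions that have none. The trace of the translate at `t = 0`
is `ψ(x, r)`, hence the integral of `z₀ ψ` over `Ω × (0, τ]`. -/
theorem HasWeakTimeDeriv.integral_timeShift {z g : Sp N × ℝ → ℝ} {b : Sp N × ℝ → Sp N}
    {z₀ : Sp N → ℝ} (H : HasWeakTimeDeriv Ω T z g b z₀) (hz : IntegrableOn z (cylinder Ω T))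
    (hz₀ : IntegrableOn z₀ Ω) {ψ : Sp N × ℝ → ℝ} (hψ : IsTestFunction (cylinder Ω T) ψ)
    {τ : ℝ} (hτ : 0 ≤ τ) :
    (∫ p in cylinder Ω T, z p * (ψ p - ψ (timeShift N τ p))) -
        ∫ p, z₀ p.1 * ψ p ∂((vol Ω).prod (volume.restrict (Ioc 0 τ))) =
      ∫ r in 0..τ, ((∫ p in cylinder Ω T, g p * ψ (timeShift N r p)) +
        ∫ p in cylinder Ω T, inner ℝ (b p) (spaceGrad ψ (timeShift N r p))) := by
  obtain ⟨C, hC⟩ := exists_abs_timeDeriv_le hψ.1 hψ.2.1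
  obtain ⟨C', hC'⟩ := hψ.1.continuous.bounded_above_of_compact_support hψ.2.1
  set ν := volume.restrict (Ioc 0 τ) with hν
  set μ := volume.restrict (cylinder Ω T) with hμ
  have hcs : Continuous fun q : (Sp N × ℝ) × ℝ => timeShift N q.2 q.1 := by
    simp only [timeShift_apply]; fun_prop
  have K1 : Integrable (fun q : (Sp N × ℝ) × ℝ => z q.1 * timeDeriv ψ (timeShift N q.2 q.1))
      (μ.prod ν) :=
    integrable_mul_of_abs_le (hz.comp_fst ν)
      ((continuous_timeDeriv hψ.1).comp hcs).aestronglyMeasurable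
      (Eventually.of_forall fun q => hC _)
  have K2 : Integrable (fun q : Sp N × ℝ => z₀ q.1 * ψ q) ((vol Ω).prod ν) :=
    integrable_mul_of_abs_le (hz₀.comp_fst ν) hψ.1.continuous.aestronglyMeasurable
      (Eventually.of_forall fun q => hC' _)
  -- The time derivative of the translate is its derivative in `r`; Fubini and the fundamental
  -- theorem of calculus in `r` apply.
  have e1 : ∫ r, ∫ p, z p * timeDeriv ψ (timeShift N r p) ∂μ ∂ν =
      ∫ p, z p * (ψ (timeShift N τ p) - ψ p) ∂μ := by
    rw [← integral_integral_swap K1]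
    refine integral_congr_ae (Eventually.of_forall fun p => ?_)
    simp only
    rw [integral_const_mul, hν, ← intervalIntegral.integral_of_le hτ,
      intervalIntegral.integral_eq_sub_of_hasDerivAt
        (fun r _ => hasDerivAt_timeShift (hψ.1.differentiable (by simp)) p r)]
    · simp [timeShift_apply]
    · refine Continuous.intervalIntegrable ?_ _ _
      exact (continuous_timeDeriv hψ.1).comp (hcs.comp (continuous_const.prodMk continuous_id))
  have e2 : ∫ r, (∫ x in Ω, z₀ x * ψ (x, r)) ∂ν = ∫ p, z₀ p.1 * ψ p ∂((vol Ω).prod ν) :=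
    (integral_prod_symm _ K2).symm
  rw [intervalIntegral.integral_of_le hτ]
  have e3 : ∀ᵐ r ∂ν, ((∫ p, g p * ψ (timeShift N r p) ∂μ) +
        ∫ p, inner ℝ (b p) (spaceGrad ψ (timeShift N r p)) ∂μ) =
      -(∫ p, z p * timeDeriv ψ (timeShift N r p) ∂μ) - ∫ x in Ω, z₀ x * ψ (x, r) := by
    filter_upwards [ae_restrict_mem measurableSet_Ioc] with r hr
    have h := H _ (hψ.timeShift hr.1.le)
    simp only [timeDeriv_timeShift] at h
    simp only [timeShift_apply, zero_add] at h ⊢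
    rw [h]
    rfl
  have I1 : Integrable (fun r => -∫ p, z p * timeDeriv ψ (timeShift N r p) ∂μ) ν :=
    K1.integral_prod_right.neg
  have I2 : Integrable (fun r => ∫ x in Ω, z₀ x * ψ (x, r)) ν := K2.integral_prod_right
  rw [integral_congr_ae e3, integral_sub I1 I2, integral_neg, e1, e2, ← integral_neg]
  congr 1
  refine integral_congr_ae (Eventually.of_forall fun p => ?_)
  simp only
  ring

end ShiftedIdentity

/-! ### Chain rule inequality in time -/

section Chain

variable {N : ℕ} {Ω : Set (Sp N)} {T : ℝ}

/-- The shifted identity passes to `φ` by approximation with uniformly bounded test functions: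
boundedness handles the `L¹` factors `z`, `g`, `z₀`, and `L²` convergence of gradients handles `b`.
The inequality comes from dropping the term with `z₀ ≤ 0 ≤ φ`. -/
theorem HasWeakTimeDeriv.integral_timeShift_le (hΩ : MeasurableSet Ω) {z g : Sp N × ℝ → ℝ}
    {b : Sp N × ℝ → Sp N} {z₀ : Sp N → ℝ} (H : HasWeakTimeDeriv Ω T z g b z₀)
    (hz : Integrable z) (hg : Integrable g) (hg' : ∀ p ∉ cylinder Ω T, g p = 0)
    (hb : MemLp b 2) (hb' : ∀ p ∉ cylinder Ω T, b p = 0)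
    (hz₀ : IntegrableOn z₀ Ω) (hz₀' : ∀ᵐ x ∂(vol Ω), z₀ x ≤ 0)
    {φ : Sp N × ℝ → ℝ} {Dφ : Sp N × ℝ → Sp N} (hφ : MemL2W012 Ω T φ Dφ)
    (hφ' : ∀ p ∉ cylinder Ω T, φ p = 0) (hDφ' : ∀ p ∉ cylinder Ω T, Dφ p = 0)
    {K : ℝ} (hK : ∀ p, |φ p| ≤ K) (h0 : ∀ p, 0 ≤ φ p) {τ : ℝ} (hτ : 0 ≤ τ) :
    ∫ p in cylinder Ω T, z p * (φ p - φ (timeShift N τ p)) ≤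
      ∫ r in 0..τ, ((∫ p, g p * φ (timeShift N r p)) +
        ∫ p, inner ℝ (b p) (Dφ (timeShift N r p))) := by
  have hQ : MeasurableSet (cylinder Ω T) := hΩ.prod measurableSet_Ioo
  obtain ⟨ψ, C, hψ, hC, hae, hgrad⟩ := hφ.exists_bounded_testFunction_seq
    (Eventually.of_forall hK)
  -- Convergence is needed on the whole space because translates leave the cylinder; outside it
  -- everything vanishes.
  have hae' : ∀ᵐ p : Sp N × ℝ, Tendsto (fun n => ψ n p) atTop (𝓝 (φ p)) := by
    filter_upwards [(ae_restrict_iff' hQ).1 hae] with p hp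
    by_cases hpQ : p ∈ cylinder Ω T
    · exact hp hpQ
    · rw [hφ' p hpQ]
      exact tendsto_const_nhds.congr fun n => ((hψ n).eq_zero_of_notMem hpQ).symm
  have haes : ∀ r : ℝ, ∀ᵐ p : Sp N × ℝ,
      Tendsto (fun n => ψ n (timeShift N r p)) atTop (𝓝 (φ (timeShift N r p))) := fun r =>
    (measurePreserving_timeShift N r).quasiMeasurePreserving.ae hae'
  have hDφ : MemLp Dφ 2 := by
    have : Dφ = (cylinder Ω T).indicator Dφ := by
      ext1 p
      by_cases hp : p ∈ cylinder Ω T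
      · rw [indicator_of_mem hp]
      · rw [indicator_of_notMem hp, hDφ' p hp]
    rw [this]
    exact (memLp_indicator_iff_restrict hQ).2 hφ.2.1
  have hψD : ∀ n, MemLp (spaceGrad (ψ n)) 2 := fun n => (hψ n).memLp_spaceGrad 2
  have hgrad' : Tendsto (fun n => eLpNorm (spaceGrad (ψ n) - Dφ) 2 volume) atTop (𝓝 0) := by
    refine hgrad.congr fun n => eLpNorm_restrict_eq_of_support_subset fun p hp => ?_
    by_contra hpQ
    exact hp (by simp [spaceGrad_eq_zero (hψ n) hpQ, hDφ' p hpQ])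
  have hψc : ∀ n r, AEStronglyMeasurable (fun p => ψ n (timeShift N r p)) volume := fun n r =>
    ((hψ n).1.continuous.comp (timeShift N r).continuous).aestronglyMeasurable
  have hA : Tendsto (fun n => ∫ p in cylinder Ω T, z p * (ψ n p - ψ n (timeShift N τ p))) atTop
      (𝓝 (∫ p in cylinder Ω T, z p * (φ p - φ (timeShift N τ p)))) := by
    refine tendsto_integral_of_dominated_convergence (fun p => ‖z p‖ * (C + C)) (fun n => ?_)
      (hz.norm.mul_const _).integrableOn (fun n => Eventually.of_forall fun p => ?_) ?_
    · exact (hz.1.mul ((hψ n).1.continuous.aestronglyMeasurable.sub (hψc n τ))).restrict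
    · rw [norm_mul]
      gcongr
      exact (norm_sub_le _ _).trans (add_le_add (hC n _) (hC n _))
    · filter_upwards [ae_restrict_of_ae hae', ae_restrict_of_ae (haes τ)] with p h1 h2
      exact (h1.sub h2).const_mul _
  have hB : Tendsto (fun n => ∫ p, z₀ p.1 * ψ n p ∂((vol Ω).prod (volume.restrict (Ioc 0 τ))))
      atTop (𝓝 (∫ p, z₀ p.1 * φ p ∂((vol Ω).prod (volume.restrict (Ioc 0 τ))))) := by
    have hi : Integrable (fun p : Sp N × ℝ => z₀ p.1)
      ((vol Ω).prod (volume.restrict (Ioc 0 τ))) := hz₀.comp_fst _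
    refine tendsto_integral_of_dominated_convergence (fun p => ‖z₀ p.1‖ * C) (fun n => ?_)
      (hi.norm.mul_const _) (fun n => Eventually.of_forall fun p => ?_) ?_
    · exact hi.1.mul (hψ n).1.continuous.aestronglyMeasurable
    · rw [norm_mul]
      gcongr
      exact hC n _
    · rw [Measure.prod_restrict, ← Measure.volume_eq_prod]
      filter_upwards [ae_restrict_of_ae hae'] with p h1
      exact h1.const_mul _
  have hB0 : ∫ p, z₀ p.1 * φ p ∂((vol Ω).prod (volume.restrict (Ioc 0 τ))) ≤ 0 := by
    refine integral_nonpos_of_ae ?_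
    have h1 : ∀ᵐ p ∂((vol Ω).prod (volume.restrict (Ioc 0 τ))), z₀ p.1 ≤ 0 :=
      Measure.quasiMeasurePreserving_fst.ae hz₀'
    filter_upwards [h1] with p hp
    exact mul_nonpos_of_nonpos_of_nonneg hp (h0 p)
  have hR : Tendsto (fun n => ∫ r in 0..τ, ((∫ p, g p * ψ n (timeShift N r p)) +
        ∫ p, inner ℝ (b p) (spaceGrad (ψ n) (timeShift N r p)))) atTop
      (𝓝 (∫ r in 0..τ, ((∫ p, g p * φ (timeShift N r p)) +
        ∫ p, inner ℝ (b p) (Dφ (timeShift N r p))))) := by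
    have hlow : ∀ᶠ n in atTop, eLpNorm (spaceGrad (ψ n) - Dφ) 2 volume < 1 :=
      hgrad'.eventually_lt_const one_pos
    have hsub : ∀ n r, (∫ p, inner ℝ (b p) (spaceGrad (ψ n) (timeShift N r p))) -
        ∫ p, inner ℝ (b p) (Dφ (timeShift N r p)) =
        ∫ p, inner ℝ (b p) ((spaceGrad (ψ n) - Dφ) (timeShift N r p)) := by
      intro n r
      have i1 : Integrable fun p => inner ℝ (b p) (spaceGrad (ψ n) (timeShift N r p)) :=
        MemLp.integrable_inner_two hb
          ((hψD n).comp_measurePreserving (measurePreserving_timeShift N r))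
      have i2 : Integrable fun p => inner ℝ (b p) (Dφ (timeShift N r p)) :=
        MemLp.integrable_inner_two hb (hDφ.comp_measurePreserving (measurePreserving_timeShift N r))
      rw [← integral_sub i1 i2]
      simp only [Pi.sub_apply, inner_sub_right]
    -- The bound is uniform in `r`. It holds once `‖∇ψ_n - Dφ‖₂ < 1`, which accounts for the factor
    -- 1.
    refine intervalIntegral.tendsto_integral_filter_of_dominated_convergence
      (fun _ => (∫ p, ‖g p‖) * C + ((eLpNorm b 2 volume).toReal * 1 +
        (eLpNorm b 2 volume).toReal * (eLpNorm Dφ 2 volume).toReal)) ?_ ?_ ?_ ?_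
    · refine Eventually.of_forall fun n => Continuous.aestronglyMeasurable ?_
      exact (continuous_integral_mul_timeShift hg (hψ n).1.continuous.aestronglyMeasurable
        (Eventually.of_forall (hC n))).add (continuous_integral_inner_timeShift hb (hψD n))
    · filter_upwards [hlow] with n hn
      refine Eventually.of_forall fun r _ => (norm_add_le _ _).trans (add_le_add ?_ ?_)
      · rw [← integral_mul_const]
        refine norm_integral_le_of_norm_le (hg.norm.mul_const _) (Eventually.of_forall fun p => ?_)
        rw [norm_mul]
        gcongr
        exact hC n _
      · rw [← sub_add_cancel (∫ p, inner ℝ (b p) (spaceGrad (ψ n) (timeShift N r p)))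
          (∫ p, inner ℝ (b p) (Dφ (timeShift N r p))), hsub]
        refine (norm_add_le _ _).trans (add_le_add ?_
          (norm_integral_inner_timeShift_le hb hDφ r))
        refine (norm_integral_inner_timeShift_le hb ((hψD n).sub hDφ) r).trans ?_
        gcongr
        exact ENNReal.toReal_le_of_le_ofReal zero_le_one (by simpa using hn.le)
    · exact intervalIntegrable_const
    · refine Eventually.of_forall fun r _ => Tendsto.add ?_ ?_
      · refine tendsto_integral_of_dominated_convergence (fun p => ‖g p‖ * C) (fun n => ?_)
          (hg.norm.mul_const _) (fun n => Eventually.of_forall fun p => ?_) ?_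
        · exact hg.1.mul (hψc n r)
        · rw [norm_mul]
          gcongr
          exact hC n _
        · filter_upwards [haes r] with p h1
          exact h1.const_mul _
      · rw [tendsto_iff_norm_sub_tendsto_zero]
        have hz : Tendsto (fun n => (eLpNorm b 2 volume).toReal *
            (eLpNorm (spaceGrad (ψ n) - Dφ) 2 volume).toReal) atTop (𝓝 0) := by
          have := (ENNReal.tendsto_toReal ENNReal.zero_ne_top).comp hgrad'
          simpa using this.const_mul (eLpNorm b 2 volume).toReal
        refine squeeze_zero (fun _ => norm_nonneg _) (fun n => ?_) hz
        rw [hsub]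
        exact norm_integral_inner_timeShift_le hb ((hψD n).sub hDφ) r
  have hid : ∀ n, (∫ p in cylinder Ω T, z p * (ψ n p - ψ n (timeShift N τ p))) -
        ∫ p, z₀ p.1 * ψ n p ∂((vol Ω).prod (volume.restrict (Ioc 0 τ))) =
      ∫ r in 0..τ, ((∫ p, g p * ψ n (timeShift N r p)) +
        ∫ p, inner ℝ (b p) (spaceGrad (ψ n) (timeShift N r p))) := by
    intro n
    rw [H.integral_timeShift hz.integrableOn hz₀ (hψ n) hτ]
    refine intervalIntegral.integral_congr fun r _ => ?_
    rw [setIntegral_eq_integral_of_forall_compl_eq_zero (fun p hp => by rw [hg' p hp, zero_mul]),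
      setIntegral_eq_integral_of_forall_compl_eq_zero
        (fun p hp => by rw [hb' p hp, inner_zero_left])]
  have := tendsto_nhds_unique ((hA.sub hB).congr hid) hR
  linarith

/-- The cut-off in time. -/
def timeWeight (T t : ℝ) : ℝ := max 0 (min T (T - t))

theorem continuous_timeWeight (T : ℝ) : Continuous (timeWeight T) := by
  unfold timeWeight; fun_prop

theorem timeWeight_nonneg (T t : ℝ) : 0 ≤ timeWeight T t := le_max_left _ _

theorem abs_timeWeight_le (hT : 0 ≤ T) (t : ℝ) : |timeWeight T t| ≤ T := by
  rw [abs_of_nonneg (timeWeight_nonneg T t)]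
  exact max_le hT (min_le_left _ _)

theorem timeWeight_sub_nonneg {τ : ℝ} (hτ : 0 ≤ τ) (t : ℝ) :
    0 ≤ timeWeight T t - timeWeight T (t + τ) := by
  unfold timeWeight
  rw [sub_nonneg]
  gcongr
  linarith

/-- The weight has slope `-1` on `(0,T)`, so after the integration by parts it leaves the unweighted
integral of `Θ(z)`. -/
theorem timeWeight_sub_eq {τ t : ℝ} (hτ : 0 ≤ τ) (ht : 0 < t) (htT : t + τ ≤ T) :
    timeWeight T t - timeWeight T (t + τ) = τ := by
  unfold timeWeight
  rw [min_eq_right (by linarith), min_eq_right (by linarith), max_eq_right (by linarith),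
    max_eq_right (by linarith)]
  ring

/-- Hypothesis `hconv` says that `S` is a subgradient of the convex function `Θ`; it replaces the
chain rule `∂Θ(z) = S(z) ∂z` at the level of finite differences. The parameter `δ` removes the final
layer, where the weight reaches 0 before dropping by the full step `τ`. -/
theorem HasWeakTimeDeriv.chain_rule_le (hT : 0 ≤ T) (hΩ : MeasurableSet Ω) {z g : Sp N × ℝ → ℝ}
    {b : Sp N × ℝ → Sp N} {z₀ : Sp N → ℝ} (H : HasWeakTimeDeriv Ω T z g b z₀)
    (hz : Integrable z) (hz' : ∀ p ∉ cylinder Ω T, z p = 0)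
    (hg : Integrable g) (hg' : ∀ p ∉ cylinder Ω T, g p = 0)
    (hb : MemLp b 2) (hb' : ∀ p ∉ cylinder Ω T, b p = 0)
    (hz₀ : IntegrableOn z₀ Ω) (hz₀' : ∀ᵐ x ∂(vol Ω), z₀ x ≤ 0)
    {S Θ : ℝ → ℝ} (hS : Continuous S) (hS0 : S 0 = 0) (hSnn : ∀ s, 0 ≤ S s) (hS1 : ∀ s, S s ≤ 1)
    (hΘ : Continuous Θ) (hΘle : ∀ s, |Θ s| ≤ |s|) (hΘnn : ∀ s, 0 ≤ Θ s)
    (hconv : ∀ a b, Θ a - Θ b ≤ S a * (a - b))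
    {φ : Sp N × ℝ → ℝ} (hφe : ∀ p, φ p = timeWeight T p.2 * S (z p))
    {Dφ : Sp N × ℝ → Sp N} (hφ : MemL2W012 Ω T φ Dφ) (hDφ' : ∀ p ∉ cylinder Ω T, Dφ p = 0)
    {δ : ℝ} (hδ : 0 < δ) :
    ∫ p in cylinder Ω T ∩ {p | p.2 ≤ T - δ}, Θ (z p) ≤
      (∫ p, g p * φ p) + ∫ p, inner ℝ (b p) (Dφ p) := by
  have hQ : MeasurableSet (cylinder Ω T) := hΩ.prod measurableSet_Ioo
  have hφ' : ∀ p ∉ cylinder Ω T, φ p = 0 := fun p hp => by rw [hφe, hz' p hp, hS0, mul_zero]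
  have hK : ∀ p, |φ p| ≤ T := fun p => by
    rw [hφe, abs_mul, abs_of_nonneg (hSnn _)]
    exact (mul_le_of_le_one_right (abs_nonneg _) (hS1 _)).trans (abs_timeWeight_le hT _)
  have h0 : ∀ p, 0 ≤ φ p := fun p => by
    rw [hφe]; exact mul_nonneg (timeWeight_nonneg _ _) (hSnn _)
  have hwc : Continuous fun p : Sp N × ℝ => timeWeight T p.2 :=
    (continuous_timeWeight T).comp continuous_snd
  have hφm : AEStronglyMeasurable φ := by
    have : φ = fun p => timeWeight T p.2 * S (z p) := funext hφe
    rw [this]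
    exact hwc.aestronglyMeasurable.mul (hS.comp_aestronglyMeasurable hz.1)
  have hDφ : MemLp Dφ 2 := by
    have : Dφ = (cylinder Ω T).indicator Dφ := by
      ext1 p
      by_cases hp : p ∈ cylinder Ω T
      · rw [indicator_of_mem hp]
      · rw [indicator_of_notMem hp, hDφ' p hp]
    rw [this]
    exact (memLp_indicator_iff_restrict hQ).2 hφ.2.1
  have hΘi : Integrable fun p => Θ (z p) :=
    hz.mono (hΘ.comp_aestronglyMeasurable hz.1) (Eventually.of_forall fun p => hΘle _)
  have hΘ0 : Θ 0 = 0 := by simpa using hΘle 0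
  set A := ∫ p in cylinder Ω T ∩ {p | p.2 ≤ T - δ}, Θ (z p) with hA
  set c : ℝ → ℝ := fun r => (∫ p, g p * φ (timeShift N r p)) +
    ∫ p, inner ℝ (b p) (Dφ (timeShift N r p)) with hc
  have hcc : Continuous c :=
    (continuous_integral_mul_timeShift hg hφm (Eventually.of_forall hK)).add
      (continuous_integral_inner_timeShift hb hDφ)
  have hstep : ∀ τ ∈ Ioc 0 δ, A * τ ≤ ∫ r in 0..τ, c r := by
    intro τ hτ
    refine le_trans ?_ (H.integral_timeShift_le hΩ hz hg hg' hb hb' hz₀ hz₀' hφ hφ' hDφ' hK h0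
      hτ.1.le)
    rw [setIntegral_eq_integral_of_forall_compl_eq_zero (fun p hp => by rw [hz' p hp, zero_mul])]
    have hzs : Integrable fun p => z (timeShift N (-τ) p) :=
      ((measurePreserving_timeShift N (-τ)).integrable_comp hz.1).2 hz
    have hΘs : Integrable fun p => Θ (z (timeShift N (-τ) p)) :=
      ((measurePreserving_timeShift N (-τ)).integrable_comp hΘi.1).2 hΘi
    have hφs : AEStronglyMeasurable fun p => φ (timeShift N τ p) :=
      hφm.comp_measurePreserving (measurePreserving_timeShift N τ)
    -- Discrete integration by parts: the translation passes from `φ` to `z`. In `e2` the same is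
    -- done for `Θ(z)` and the weight.
    have e1 : ∫ p, z p * (φ p - φ (timeShift N τ p)) =
        ∫ p, (z p - z (timeShift N (-τ) p)) * φ p := by
      simp only [mul_sub, sub_mul]
      rw [integral_sub (integrable_mul_of_abs_le hz hφm (Eventually.of_forall hK))
        (integrable_mul_of_abs_le hz hφs (Eventually.of_forall fun p => hK _)),
        integral_sub (integrable_mul_of_abs_le hz hφm (Eventually.of_forall hK))
        (integrable_mul_of_abs_le hzs hφm (Eventually.of_forall hK)),
        ← integral_comp_timeShift (-τ) (fun p => z p * φ (timeShift N τ p))]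
      simp only [timeShift_neg_apply]
    have hwb : ∀ᵐ p : Sp N × ℝ, |timeWeight T p.2| ≤ T :=
      Eventually.of_forall fun p => abs_timeWeight_le hT _
    have hwcs : Continuous fun p : Sp N × ℝ => timeWeight T (p.2 + τ) :=
      (continuous_timeWeight T).comp (by fun_prop)
    have hwbs : ∀ᵐ p : Sp N × ℝ, |timeWeight T (p.2 + τ)| ≤ T :=
      Eventually.of_forall fun p => abs_timeWeight_le hT _
    have i1 := integrable_mul_of_abs_le hΘi hwc.aestronglyMeasurable hwb
    have i2 := integrable_mul_of_abs_le hΘs hwc.aestronglyMeasurable hwb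
    have i3 := integrable_mul_of_abs_le hΘi hwcs.aestronglyMeasurable hwbs
    have e2 : ∫ p, (Θ (z p) - Θ (z (timeShift N (-τ) p))) * timeWeight T p.2 =
        ∫ p, Θ (z p) * (timeWeight T p.2 - timeWeight T (p.2 + τ)) := by
      simp only [mul_sub, sub_mul]
      rw [integral_sub i1 i2, integral_sub i1 i3, ← integral_comp_timeShift (-τ)
        (fun p => Θ (z p) * timeWeight T (p.2 + τ))]
      simp [timeShift_apply]
    rw [e1]
    calc A * τ = ∫ p, (cylinder Ω T ∩ {p | p.2 ≤ T - δ}).indicator (fun p => Θ (z p) * τ) p := by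
          rw [integral_indicator (hQ.inter (measurableSet_le measurable_snd measurable_const)),
            integral_mul_const]
      _ ≤ ∫ p, Θ (z p) * (timeWeight T p.2 - timeWeight T (p.2 + τ)) := by
          refine integral_mono_of_nonneg (Eventually.of_forall fun p => ?_) ?_
            (Eventually.of_forall fun p => ?_)
          · exact indicator_nonneg (fun p _ => mul_nonneg (hΘnn _) hτ.1.le) p
          · simp only [mul_sub]
            exact i1.sub i3
          · simp only
            by_cases hp : p ∈ cylinder Ω T ∩ {p | p.2 ≤ T - δ}
            · rw [indicator_of_mem hp, timeWeight_sub_eq hτ.1.le hp.1.2.1]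
              have : p.2 ≤ T - δ := hp.2
              linarith [hτ.2]
            · rw [indicator_of_notMem hp]
              exact mul_nonneg (hΘnn _) (timeWeight_sub_nonneg hτ.1.le _)
      _ = ∫ p, (Θ (z p) - Θ (z (timeShift N (-τ) p))) * timeWeight T p.2 := e2.symm
      _ ≤ ∫ p, (z p - z (timeShift N (-τ) p)) * φ p := by
          refine integral_mono ?_ ?_ fun p => ?_
          · simp only [sub_mul]
            exact i1.sub i2
          · exact integrable_mul_of_abs_le (hz.sub hzs) hφm (Eventually.of_forall hK)
          · simp only
            rw [hφe]
            have := mul_le_mul_of_nonneg_right (hconv (z p) (z (timeShift N (-τ) p)))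
              (timeWeight_nonneg T p.2)
            linarith
  have hc0 : c 0 = (∫ p, g p * φ p) + ∫ p, inner ℝ (b p) (Dφ p) := by
    simp [hc, timeShift_apply]
  rw [← hc0]
  -- Divide by `τ → 0`: if `c 0 < m < A`, continuity gives `c < m` on a short interval `[0, τ]`,
  -- contradicting `A τ ≤ ∫ c`.
  by_contra! hlt
  obtain ⟨m, hm1, hm2⟩ := exists_between hlt
  obtain ⟨ε, hε, hball⟩ := Metric.mem_nhds_iff.1
    ((hcc.tendsto 0).eventually_lt_const hm1)
  set τ := min δ (ε / 2) with hτdef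
  have hτ : 0 < τ := lt_min hδ (by linarith)
  have h1 := hstep τ ⟨hτ, min_le_left _ _⟩
  have h2 : ∫ r in 0..τ, c r ≤ ∫ _ in 0..τ, m := by
    refine intervalIntegral.integral_mono_on hτ.le (hcc.intervalIntegrable _ _)
      intervalIntegrable_const fun r hr => ?_
    refine le_of_lt (hball ?_)
    rw [mem_ball_zero_iff, Real.norm_eq_abs, abs_of_nonneg hr.1]
    linarith [hr.2, min_le_right δ (ε / 2)]
  rw [intervalIntegral.integral_const, sub_zero, smul_eq_mul] at h2
  nlinarith

end Chain

/-! ### The smooth transition and its convex primitive -/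

section Transition

/-- The derivative is continuous and vanishes off `[0,1]`, where `s² ≤ 1`. The last bound, used at
`kz`, is the source of the factor `1/k` in the energy estimate. -/
theorem exists_deriv_smoothTransition_bound : ∃ C : ℝ, ∀ s,
    0 ≤ deriv Real.smoothTransition s ∧ deriv Real.smoothTransition s ≤ C ∧
      s ^ 2 * deriv Real.smoothTransition s ≤ C := by
  have hd0 : ∀ s, s ∉ Icc (0 : ℝ) 1 → deriv Real.smoothTransition s = 0 := by
    intro s hs
    rcases lt_or_ge s 0 with h | h
    · have : Real.smoothTransition =ᶠ[𝓝 s] fun _ => 0 := by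
        filter_upwards [gt_mem_nhds h] with r hr using Real.smoothTransition.zero_of_nonpos hr.le
      rw [this.deriv_eq, deriv_const]
    · have h1 : 1 < s := by
        by_contra! h1
        exact hs ⟨h, h1⟩
      have : Real.smoothTransition =ᶠ[𝓝 s] fun _ => 1 := by
        filter_upwards [lt_mem_nhds h1] with r hr using Real.smoothTransition.one_of_one_le hr.le
      rw [this.deriv_eq, deriv_const]
  have hc : Continuous (deriv Real.smoothTransition) :=
    (Real.smoothTransition.contDiff (n := 1)).continuous_deriv le_rfl
  obtain ⟨C, hC⟩ := hc.bounded_above_of_compact_support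
    (HasCompactSupport.intro isCompact_Icc hd0)
  refine ⟨C, fun s => ⟨Real.smoothTransition.monotone.deriv_nonneg, (le_abs_self _).trans (hC s), ?_⟩⟩
  have h0 : 0 ≤ deriv Real.smoothTransition s := Real.smoothTransition.monotone.deriv_nonneg
  have h1 := (le_abs_self _).trans (hC s)
  by_cases hs : s ∈ Icc (0 : ℝ) 1
  · refine le_trans (mul_le_of_le_one_left h0 ?_) h1
    have := hs.1
    have := hs.2
    nlinarith
  · rw [hd0 s hs, mul_zero]
    exact (norm_nonneg _).trans (hC s)

/-- The primitive of a nondecreasing function is convex and lies above its tangent at `a`. -/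
theorem sub_le_mul_of_monotone {S : ℝ → ℝ} (hS : Continuous S) (hmono : Monotone S) (a b : ℝ) :
    (∫ r in 0..a, S r) - ∫ r in 0..b, S r ≤ S a * (a - b) := by
  rw [intervalIntegral.integral_interval_sub_left (hS.intervalIntegrable _ _)
    (hS.intervalIntegrable _ _)]
  rcases le_total b a with h | h
  · calc ∫ r in b..a, S r ≤ ∫ _ in b..a, S a :=
          intervalIntegral.integral_mono_on h (hS.intervalIntegrable _ _)
            intervalIntegrable_const fun r hr => hmono hr.2
      _ = S a * (a - b) := by simp [mul_comm]
  · rw [intervalIntegral.integral_symm, neg_le]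
    calc -(S a * (a - b)) = ∫ _ in a..b, S a := by
          rw [intervalIntegral.integral_const, smul_eq_mul]; ring
      _ ≤ ∫ r in a..b, S r :=
          intervalIntegral.integral_mono_on h intervalIntegrable_const
            (hS.intervalIntegrable _ _) fun r hr => hmono hr.1

end Transition

/-! ### Reduction to an equation for the difference -/

section Reduction

variable {N : ℕ} {Ω : Set (Sp N)} {T : ℝ}

theorem HasTimeDerivative.hasWeakTimeDeriv {v : Sp N × ℝ → ℝ} {G : ℝ → Wm12 Ω}
    {g : Sp N × ℝ → ℝ} {v₀ : Sp N → ℝ} (h : HasTimeDerivative Ω T v G g v₀)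
    (hg : IntegrableOn g (cylinder Ω T)) {a : Sp N × ℝ → ℝ} {b : Sp N × ℝ → Sp N}
    (ha : MemLp a 2 (volume.restrict (cylinder Ω T)))
    (hab : ∀ φ Dφ, MemL2W012 Ω T φ Dφ → duality Ω T G φ Dφ =
        (∫ p in cylinder Ω T, a p * φ p) + ∫ p in cylinder Ω T, inner ℝ (b p) (Dφ p)) :
    HasWeakTimeDeriv Ω T v (a + g) b v₀ := by
  intro ψ hψ
  obtain ⟨C, hC⟩ := hψ.1.continuous.bounded_above_of_compact_support hψ.2.1
  rw [h ψ hψ, hab ψ _ hψ.memL2W012]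
  have i1 := MemLp.integrable_mul_two ha (hψ.memLp 2)
  have i2 := integrable_mul_of_abs_le hg hψ.1.continuous.aestronglyMeasurable
    (Eventually.of_forall hC)
  simp only [Pi.add_apply, add_mul]
  rw [integral_add i1 i2]
  ring

theorem HasWeakTimeDeriv.sub {v w g g' : Sp N × ℝ → ℝ} {b b' : Sp N × ℝ → Sp N}
    {v₀ w₀ : Sp N → ℝ} (h : HasWeakTimeDeriv Ω T v g b v₀) (h' : HasWeakTimeDeriv Ω T w g' b' w₀)
    (hv : IntegrableOn v (cylinder Ω T)) (hw : IntegrableOn w (cylinder Ω T))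
    (hg : IntegrableOn g (cylinder Ω T)) (hg' : IntegrableOn g' (cylinder Ω T))
    (hb : MemLp b 2 (volume.restrict (cylinder Ω T)))
    (hb' : MemLp b' 2 (volume.restrict (cylinder Ω T)))
    (hv₀ : IntegrableOn v₀ Ω) (hw₀ : IntegrableOn w₀ Ω) :
    HasWeakTimeDeriv Ω T (v - w) (g - g') (b - b') (v₀ - w₀) := by
  intro ψ hψ
  obtain ⟨C, hC⟩ := hψ.1.continuous.bounded_above_of_compact_support hψ.2.1
  obtain ⟨C', hC'⟩ := exists_abs_timeDeriv_le hψ.1 hψ.2.1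
  have iv : ∀ {u : Sp N × ℝ → ℝ}, IntegrableOn u (cylinder Ω T) →
      Integrable (fun p => u p * timeDeriv ψ p) (volume.restrict (cylinder Ω T)) := fun hu =>
    integrable_mul_of_abs_le hu (continuous_timeDeriv hψ.1).aestronglyMeasurable
      (Eventually.of_forall hC')
  have ig : ∀ {u : Sp N × ℝ → ℝ}, IntegrableOn u (cylinder Ω T) →
      Integrable (fun p => u p * ψ p) (volume.restrict (cylinder Ω T)) := fun hu =>
    integrable_mul_of_abs_le hu hψ.1.continuous.aestronglyMeasurable (Eventually.of_forall hC)
  have i0 : ∀ {u : Sp N → ℝ}, IntegrableOn u Ω →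
      Integrable (fun x => u x * ψ (x, 0)) (vol Ω) := fun hu =>
    integrable_mul_of_abs_le hu
      (hψ.1.continuous.comp (continuous_id.prodMk continuous_const)).aestronglyMeasurable
      (Eventually.of_forall fun x => hC _)
  have ib : ∀ {u : Sp N × ℝ → Sp N}, MemLp u 2 (volume.restrict (cylinder Ω T)) →
      Integrable (fun p => inner ℝ (u p) (spaceGrad ψ p)) (volume.restrict (cylinder Ω T)) :=
    fun hu => MemLp.integrable_inner_two hu (hψ.memLp_spaceGrad 2)
  simp only [Pi.sub_apply, sub_mul, inner_sub_left]
  rw [integral_sub (iv hv) (iv hw), integral_sub (ig hg) (ig hg'), integral_sub (i0 hv₀) (i0 hw₀),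
    integral_sub (ib hb) (ib hb')]
  linarith [h ψ hψ, h' ψ hψ]

theorem HasWeakTimeDeriv.indicator (hΩ : MeasurableSet Ω) {z g : Sp N × ℝ → ℝ}
    {b : Sp N × ℝ → Sp N} {z₀ : Sp N → ℝ} (h : HasWeakTimeDeriv Ω T z g b z₀) :
    HasWeakTimeDeriv Ω T ((cylinder Ω T).indicator z) ((cylinder Ω T).indicator g)
      ((cylinder Ω T).indicator b) z₀ := by
  have hQ : MeasurableSet (cylinder Ω T) := hΩ.prod measurableSet_Ioo
  intro ψ hψ
  have e1 : ∫ p in cylinder Ω T, (cylinder Ω T).indicator z p * timeDeriv ψ p =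
      ∫ p in cylinder Ω T, z p * timeDeriv ψ p :=
    setIntegral_congr_fun hQ fun p hp => by simp only [indicator_of_mem hp]
  have e2 : ∫ p in cylinder Ω T, (cylinder Ω T).indicator g p * ψ p =
      ∫ p in cylinder Ω T, g p * ψ p :=
    setIntegral_congr_fun hQ fun p hp => by simp only [indicator_of_mem hp]
  have e3 : ∫ p in cylinder Ω T, inner ℝ ((cylinder Ω T).indicator b p) (spaceGrad ψ p) =
      ∫ p in cylinder Ω T, inner ℝ (b p) (spaceGrad ψ p) :=
    setIntegral_congr_fun hQ fun p hp => by simp only [indicator_of_mem hp]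
  rw [e1, e2, e3]
  exact h ψ hψ

theorem MemL2W012.indicator (hΩ : MeasurableSet Ω) {u : Sp N × ℝ → ℝ} {Du : Sp N × ℝ → Sp N}
    (h : MemL2W012 Ω T u Du) :
    MemL2W012 Ω T ((cylinder Ω T).indicator u) ((cylinder Ω T).indicator Du) := by
  have hQ : MeasurableSet (cylinder Ω T) := hΩ.prod measurableSet_Ioo
  refine ⟨(memLp_congr_ae (indicator_ae_eq_restrict hQ)).2 h.1,
    (memLp_congr_ae (indicator_ae_eq_restrict hQ)).2 h.2.1, ?_⟩
  filter_upwards [h.2.2, ae_restrict_mem measurableSet_Ioo] with t ⟨p, hp⟩ ht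
  refine ⟨p, hp.1.trans ?_, hp.2.trans ?_⟩ <;>
  · filter_upwards [ae_restrict_mem hΩ] with x hx
    have hm : (x, t) ∈ cylinder Ω T := ⟨hx, ht⟩
    rw [indicator_of_mem hm]

theorem matForm_smul_right (A : Matrix (Fin N) (Fin N) ℝ) (ξ η : Sp N) (c : ℝ) :
    matForm A ξ (c • η) = c * matForm A ξ η := by
  simp [matForm, dotProduct_smul]

theorem matForm_sub_left (A : Matrix (Fin N) (Fin N) ℝ) (ξ ξ' η : Sp N) :
    matForm A (ξ - ξ') η = matForm A ξ η - matForm A ξ' η := by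
  simp [matForm, Matrix.mulVec_sub, sub_dotProduct]

end Reduction

/-! ### Energy estimate and comparison -/

section Comparison

variable {N : ℕ} {Ω : Set (Sp N)} {T : ℝ}

/-- To be read with `s = z`, `d = |∇z|`, `H = h(v) - h(w)`, `e = |E|`, `i = E · ∇z`, `M = M∇z · ∇z`
and `c = ω k S'(kz)`. It is Young's inequality `ρ|s|d ≤ α d² + ρ² s² / (4α)`, whose first term is
absorbed by ellipticity. -/
theorem weighted_young {α ρ s d H e M C τ k : ℝ} (hα : 0 < α) (hH : |H| * e ≤ ρ * |s|) (hd : 0 ≤ d)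
    {i : ℝ} (hi : |i| ≤ e * d) (hM : α * d ^ 2 ≤ M) {c : ℝ} (hc : 0 ≤ c)
    (hcs : c * s ^ 2 ≤ τ * C / k) :
    c * (H * i - M) ≤ τ * C / k / (4 * α) * ρ ^ 2 := by
  have h1 : H * i ≤ ρ * |s| * d := by
    calc H * i ≤ |H * i| := le_abs_self _
      _ = |H| * |i| := abs_mul _ _
      _ ≤ |H| * (e * d) := by gcongr
      _ = |H| * e * d := by ring
      _ ≤ ρ * |s| * d := by gcongr
  have h2 : ρ * |s| * d - α * d ^ 2 ≤ ρ ^ 2 * s ^ 2 / (4 * α) := by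
    rw [le_div_iff₀ (by positivity), ← sq_abs s]
    nlinarith [sq_nonneg (2 * α * d - ρ * |s|)]
  calc c * (H * i - M) ≤ c * (ρ ^ 2 * s ^ 2 / (4 * α)) := by gcongr; linarith
    _ = (c * s ^ 2) * (ρ ^ 2 / (4 * α)) := by ring
    _ ≤ (τ * C / k) * (ρ ^ 2 / (4 * α)) := by gcongr
    _ = _ := by ring

/-- The primitive of `s ↦ smoothTransition (k s)`. -/
def smoothPositivePart (k s : ℝ) : ℝ := ∫ r in 0..s, Real.smoothTransition (k * r)

theorem continuous_smoothTransition_mul (k : ℝ) :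
    Continuous fun r => Real.smoothTransition (k * r) :=
  Real.smoothTransition.continuous.comp (continuous_const.mul continuous_id)

theorem smoothPositivePart_sub_le {k : ℝ} (hk : 0 ≤ k) (a b : ℝ) :
    smoothPositivePart k a - smoothPositivePart k b ≤ Real.smoothTransition (k * a) * (a - b) :=
  sub_le_mul_of_monotone (continuous_smoothTransition_mul k)
    (fun _ _ h => Real.smoothTransition.monotone (mul_le_mul_of_nonneg_left h hk)) a b

theorem smoothPositivePart_zero (k : ℝ) : smoothPositivePart k 0 = 0 :=
  intervalIntegral.integral_same

/-- The tangent at 0 is horizontal. -/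
theorem smoothPositivePart_nonneg {k : ℝ} (hk : 0 ≤ k) (s : ℝ) : 0 ≤ smoothPositivePart k s := by
  have := smoothPositivePart_sub_le hk 0 s
  simp only [smoothPositivePart_zero, mul_zero, Real.smoothTransition.zero, zero_mul] at this
  linarith

theorem abs_smoothPositivePart_le (k s : ℝ) : |smoothPositivePart k s| ≤ |s| := by
  have := intervalIntegral.norm_integral_le_of_norm_le_const (a := 0) (b := s) (C := 1)
    (f := fun r => Real.smoothTransition (k * r)) fun r _ => by
      rw [Real.norm_eq_abs, abs_of_nonneg (Real.smoothTransition.nonneg _)]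
      exact Real.smoothTransition.le_one _
  simpa [smoothPositivePart] using this

/-- The tangent at `1/k` has slope 1 and starts from a nonnegative value. -/
theorem sub_inv_le_smoothPositivePart {k : ℝ} (hk : 0 < k) (s : ℝ) :
    s - k⁻¹ ≤ smoothPositivePart k s := by
  have h := smoothPositivePart_sub_le hk.le k⁻¹ s
  rw [mul_inv_cancel₀ hk.ne', Real.smoothTransition.one, one_mul] at h
  linarith [smoothPositivePart_nonneg hk.le k⁻¹]

theorem continuous_smoothPositivePart (k : ℝ) : Continuous (smoothPositivePart k) :=
  intervalIntegral.continuous_primitive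
    (fun _ _ => (continuous_smoothTransition_mul k).intervalIntegrable _ _) 0

theorem deriv_smoothTransition_mul (k s : ℝ) :
    deriv (fun r => Real.smoothTransition (k * r)) s = k * deriv Real.smoothTransition (k * s) := by
  rw [deriv_comp_mul_left, smul_eq_mul]

/-- The energy estimate for the difference of a subsolution and a supersolution. -/
theorem exists_integral_smoothPositivePart_le (hΩ : IsOpen Ω) (hΩb : Bornology.IsBounded Ω)
    (hT : 0 < T) {α β : ℝ} (hα : 0 < α)
    {M : Sp N × ℝ → Matrix (Fin N) (Fin N) ℝ} (hM : IsElliptic Ω T α β M)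
    {h : ℝ → ℝ} {E : Sp N × ℝ → Sp N} {f : ℝ → Wm12 Ω} {v w : Sp N × ℝ → ℝ}
    (hv : IsSubsolution Ω T M h E f v) (hw : IsSupersolution Ω T M h E f w)
    {ρ : Sp N × ℝ → ℝ} (hρ : MemLp ρ 2 (volume.restrict (cylinder Ω T)))
    (hlip : ∀ᵐ p ∂(volume.restrict (cylinder Ω T)),
      |h (v p) - h (w p)| * ‖E p‖ ≤ ρ p * |v p - w p|) :
    ∃ B, ∀ k, 0 < k → ∀ δ, 0 < δ →
      ∫ p in cylinder Ω T ∩ {p | p.2 ≤ T - δ},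
        smoothPositivePart k ((cylinder Ω T).indicator (v - w) p) ≤ B / k := by
  obtain ⟨Dv, Gv, gv, v₀, hvc, hv₀, hvi⟩ := hv
  obtain ⟨Dw, Gw, gw, w₀, hwc, hw₀, hwi⟩ := hw
  have hΩm := hΩ.measurableSet
  have hQ : MeasurableSet (cylinder Ω T) := hΩm.prod measurableSet_Ioo
  have hfin : IsFiniteMeasure (volume.restrict (cylinder Ω T)) :=
    ⟨by rw [Measure.restrict_apply_univ]
        exact (hΩb.prod (Metric.isBounded_Ioo 0 T)).measure_lt_top⟩
  obtain ⟨av, bv, hav, hbv, hGv⟩ := exists_duality_eq_integral hvc.memG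
  obtain ⟨aw, bw, haw, hbw, hGw⟩ := exists_duality_eq_integral hwc.memG
  have Hv := hvc.timeDerivative.hasWeakTimeDeriv hvc.memg hav hGv
  have Hw := hwc.timeDerivative.hasWeakTimeDeriv hwc.memg haw hGw
  have hvI : IntegrableOn v (cylinder Ω T) := hvc.mem.1.integrable one_le_two
  have hwI : IntegrableOn w (cylinder Ω T) := hwc.mem.1.integrable one_le_two
  have hgvI : IntegrableOn (av + gv) (cylinder Ω T) := (hav.integrable one_le_two).add hvc.memg
  have hgwI : IntegrableOn (aw + gw) (cylinder Ω T) := (haw.integrable one_le_two).add hwc.memg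
  -- The difference is extended by zero outside the cylinder, so that time translations act on the
  -- whole space.
  have H := (Hv.sub Hw hvI hwI hgvI hgwI hbv hbw hvc.mem₀ hwc.mem₀).indicator hΩm
  set z := (cylinder Ω T).indicator (v - w) with hz
  set g := (cylinder Ω T).indicator (av + gv - (aw + gw)) with hg
  set b := (cylinder Ω T).indicator (bv - bw) with hb
  set Dz := (cylinder Ω T).indicator (Dv - Dw) with hDz
  have hzI : Integrable z := (integrable_indicator_iff hQ).2 (hvI.sub hwI)
  have hgI : Integrable g := (integrable_indicator_iff hQ).2 (hgvI.sub hgwI)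
  have hbL : MemLp b 2 := (memLp_indicator_iff_restrict hQ).2 (hbv.sub hbw)
  have hz' : ∀ p ∉ cylinder Ω T, z p = 0 := fun p hp => indicator_of_notMem hp _
  have hg' : ∀ p ∉ cylinder Ω T, g p = 0 := fun p hp => indicator_of_notMem hp _
  have hb' : ∀ p ∉ cylinder Ω T, b p = 0 := fun p hp => indicator_of_notMem hp _
  have hDz' : ∀ p ∉ cylinder Ω T, Dz p = 0 := fun p hp => indicator_of_notMem hp _
  have hzm : MemL2W012 Ω T z Dz := (hvc.mem.sub hwc.mem).indicator hΩm
  have hz₀' : ∀ᵐ x ∂(vol Ω), (v₀ - w₀) x ≤ 0 := by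
    filter_upwards [hv₀, hw₀] with x h1 h2
    simp only [Pi.sub_apply]
    linarith
  obtain ⟨C, hC⟩ := exists_deriv_smoothTransition_bound
  -- The constant depends neither on `k` nor on `δ`.
  refine ⟨T * C / (4 * α) * ∫ p in cylinder Ω T, ρ p ^ 2, fun k hk δ hδ => ?_⟩
  have hSs : ContDiff ℝ ∞ fun s => Real.smoothTransition (k * s) :=
    Real.smoothTransition.contDiff.comp (contDiff_const.mul contDiff_id)
  have hSd : ∀ s, |deriv (fun s => Real.smoothTransition (k * s)) s| ≤ k * C := fun s => by
    rw [deriv_smoothTransition_mul, abs_mul, abs_of_pos hk, abs_of_nonneg (hC _).1]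
    gcongr
    exact (hC _).2.1
  set φ : Sp N × ℝ → ℝ := fun p => timeWeight T p.2 * Real.smoothTransition (k * z p) with hφdef
  set Dφ : Sp N × ℝ → Sp N := fun p => timeWeight T p.2 •
    (deriv (fun s => Real.smoothTransition (k * s)) (z p) • Dz p) with hDφdef
  have hφ : MemL2W012 Ω T φ Dφ :=
    (hzm.comp hSs (by simp) hSd).time_smul (continuous_timeWeight T)
      (fun t _ => abs_timeWeight_le hT.le t) hΩm
  have hφ0 : ∀ p, 0 ≤ φ p := fun p =>
    mul_nonneg (timeWeight_nonneg _ _) (Real.smoothTransition.nonneg _)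
  have hφT : ∀ p, |φ p| ≤ T := fun p => by
    rw [hφdef, abs_mul, abs_of_nonneg (Real.smoothTransition.nonneg _)]
    exact (mul_le_of_le_one_right (abs_nonneg _) (Real.smoothTransition.le_one _)).trans
      (abs_timeWeight_le hT.le _)
  have hDφ' : ∀ p ∉ cylinder Ω T, Dφ p = 0 := fun p hp => by
    simp only [hDφdef, hDz' p hp, smul_zero]
  have htest : IsNonnegTest Ω T φ Dφ :=
    ⟨hφ, memLp_top_of_bound hφ.1.1 T (Eventually.of_forall hφT), Eventually.of_forall hφ0⟩
  have hchain := H.chain_rule_le hT.le hΩm hzI hz' hgI hg' hbL hb' (hvc.mem₀.sub hwc.mem₀) hz₀'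
    (continuous_smoothTransition_mul k) (by simp) (fun s => Real.smoothTransition.nonneg _)
    (fun s => Real.smoothTransition.le_one _) (continuous_smoothPositivePart k)
    (abs_smoothPositivePart_le k) (smoothPositivePart_nonneg hk.le)
    (smoothPositivePart_sub_le hk.le) (φ := φ) (fun p => rfl) hφ hDφ' hδ
  refine hchain.trans ?_
  have h1 := hvi φ Dφ htest
  have h2 := hwi φ Dφ htest
  simp only [lhs, rhs, hGv φ Dφ hφ] at h1
  simp only [lhs, rhs, hGw φ Dφ hφ] at h2
  have ibv := MemLp.integrable_inner_two hbv hφ.2.1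
  have ibw := MemLp.integrable_inner_two hbw hφ.2.1
  have ig : ∀ {u : Sp N × ℝ → ℝ}, IntegrableOn u (cylinder Ω T) →
      Integrable (fun p => u p * φ p) (volume.restrict (cylinder Ω T)) := fun hu =>
    integrable_mul_of_abs_le hu hφ.1.1 (Eventually.of_forall hφT)
  have iav := ig (hav.integrable one_le_two)
  have iaw := ig (haw.integrable one_le_two)
  have igv := ig hvc.memg
  have igw := ig hwc.memg
  have e1 : ∫ p, g p * φ p = (∫ p in cylinder Ω T, av p * φ p) + (∫ p in cylinder Ω T, gv p * φ p) -
      ((∫ p in cylinder Ω T, aw p * φ p) + ∫ p in cylinder Ω T, gw p * φ p) := by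
    rw [← setIntegral_eq_integral_of_forall_compl_eq_zero (s := cylinder Ω T)
      (fun p hp => by rw [hg' p hp, zero_mul]), ← integral_add iav igv, ← integral_add iaw igw,
      ← integral_sub (iav.fun_add igv) (iaw.fun_add igw)]
    refine setIntegral_congr_fun hQ fun p hp => ?_
    simp only [hg, indicator_of_mem hp, Pi.sub_apply, Pi.add_apply]
    ring
  have e2 : ∫ p, inner ℝ (b p) (Dφ p) = (∫ p in cylinder Ω T, inner ℝ (bv p) (Dφ p)) -
      ∫ p in cylinder Ω T, inner ℝ (bw p) (Dφ p) := by
    rw [← setIntegral_eq_integral_of_forall_compl_eq_zero (s := cylinder Ω T)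
      (fun p hp => by rw [hb' p hp, inner_zero_left]), ← integral_sub ibv ibw]
    refine setIntegral_congr_fun hQ fun p hp => ?_
    simp only [hb, indicator_of_mem hp, Pi.sub_apply, inner_sub_left]
  have im1 := hvc.integrable_diffusion φ Dφ htest
  have im2 := hwc.integrable_diffusion φ Dφ htest
  have ic1 := hvc.integrable_convection φ Dφ htest
  have ic2 := hwc.integrable_convection φ Dφ htest
  have e3 : ∫ p in cylinder Ω T, ((h (v p) * inner ℝ (E p) (Dφ p) - h (w p) * inner ℝ (E p) (Dφ p)) -
      (matForm (M p) (Dv p) (Dφ p) - matForm (M p) (Dw p) (Dφ p))) =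
      ((∫ p in cylinder Ω T, h (v p) * inner ℝ (E p) (Dφ p)) -
        ∫ p in cylinder Ω T, h (w p) * inner ℝ (E p) (Dφ p)) -
      ((∫ p in cylinder Ω T, matForm (M p) (Dv p) (Dφ p)) -
        ∫ p in cylinder Ω T, matForm (M p) (Dw p) (Dφ p)) := by
    rw [integral_sub (ic1.fun_sub ic2) (im1.fun_sub im2), integral_sub ic1 ic2, integral_sub im1 im2]
  have hpt : ∫ p in cylinder Ω T,
      ((h (v p) * inner ℝ (E p) (Dφ p) - h (w p) * inner ℝ (E p) (Dφ p)) -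
      (matForm (M p) (Dv p) (Dφ p) - matForm (M p) (Dw p) (Dφ p))) ≤
      ∫ p in cylinder Ω T, T * C / k / (4 * α) * ρ p ^ 2 := by
    refine integral_mono_ae ((ic1.fun_sub ic2).fun_sub (im1.fun_sub im2)) (hρ.integrable_sq.const_mul _) ?_
    filter_upwards [hlip, hM.2, ae_restrict_mem hQ] with p hp1 hp2 hpQ
    have hzp : z p = v p - w p := by simp only [hz, indicator_of_mem hpQ, Pi.sub_apply]
    have hDzp : Dz p = Dv p - Dw p := by simp only [hDz, indicator_of_mem hpQ, Pi.sub_apply]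
    rw [← matForm_sub_left, ← hDzp]
    have hd := hC (k * z p)
    -- The weight `c` satisfies `c z² = ω (kz)² S'(kz) / k ≤ T C / k`.
    have key := weighted_young (ρ := ρ p) (s := z p) (H := h (v p) - h (w p)) (e := ‖E p‖)
      (M := matForm (M p) (Dz p) (Dz p)) (C := C) (τ := T) (k := k)
      hα (by rw [hzp]; exact hp1) (norm_nonneg (Dz p))
      (abs_real_inner_le_norm (E p) (Dz p)) (hp2 (Dz p)).1
      (c := timeWeight T p.2 * (k * deriv Real.smoothTransition (k * z p)))
      (mul_nonneg (timeWeight_nonneg _ _) (mul_nonneg hk.le hd.1)) (by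
        have h3 : timeWeight T p.2 ≤ T := (le_abs_self _).trans (abs_timeWeight_le hT.le _)
        have h4 := hd.2.2
        calc timeWeight T p.2 * (k * deriv Real.smoothTransition (k * z p)) * z p ^ 2
            = timeWeight T p.2 * ((k * z p) ^ 2 * deriv Real.smoothTransition (k * z p)) / k := by
              field_simp
          _ ≤ T * C / k := by
              gcongr
              exact mul_nonneg (sq_nonneg _) hd.1)
    refine le_trans (le_of_eq ?_) key
    simp only [hDφdef, smul_smul, inner_smul_right, matForm_smul_right, deriv_smoothTransition_mul]
    ring
  rw [integral_const_mul] at hpt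
  have e4 : T * C / (4 * α) * (∫ p in cylinder Ω T, ρ p ^ 2) / k =
      T * C / k / (4 * α) * ∫ p in cylinder Ω T, ρ p ^ 2 := by
    field_simp
  rw [e1, e2, e4]
  linarith

/-- On each slab `t ≤ T - δ`, `z⁺ ≤ Θ_k(z) + 1/k` and finiteness of the measure give `∫ z⁺ =
O(1/k)`, so `z⁺ = 0` there. -/
theorem ae_le_of_subsolution_of_supersolution (hΩ : IsOpen Ω) (hΩb : Bornology.IsBounded Ω)
    (hT : 0 < T) {α β : ℝ} (hα : 0 < α)
    {M : Sp N × ℝ → Matrix (Fin N) (Fin N) ℝ} (hM : IsElliptic Ω T α β M)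
    {h : ℝ → ℝ} {E : Sp N × ℝ → Sp N} {f : ℝ → Wm12 Ω} {v w : Sp N × ℝ → ℝ}
    (hv : IsSubsolution Ω T M h E f v) (hw : IsSupersolution Ω T M h E f w)
    {ρ : Sp N × ℝ → ℝ} (hρ : MemLp ρ 2 (volume.restrict (cylinder Ω T)))
    (hlip : ∀ᵐ p ∂(volume.restrict (cylinder Ω T)),
      |h (v p) - h (w p)| * ‖E p‖ ≤ ρ p * |v p - w p|) :
    ∀ᵐ p ∂(volume.restrict (cylinder Ω T)), v p ≤ w p := by
  obtain ⟨B, hB⟩ := exists_integral_smoothPositivePart_le hΩ hΩb hT hα hM hv hw hρ hlip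
  obtain ⟨Dv, Gv, gv, v₀, hvc, -⟩ := hv
  obtain ⟨Dw, Gw, gw, w₀, hwc, -⟩ := hw
  have hQ : MeasurableSet (cylinder Ω T) := hΩ.measurableSet.prod measurableSet_Ioo
  have hfin : IsFiniteMeasure (volume.restrict (cylinder Ω T)) :=
    ⟨by rw [Measure.restrict_apply_univ]
        exact (hΩb.prod (Metric.isBounded_Ioo 0 T)).measure_lt_top⟩
  have hzI : IntegrableOn (v - w) (cylinder Ω T) :=
    (hvc.mem.1.integrable one_le_two).sub (hwc.mem.1.integrable one_le_two)
  have hslab : ∀ δ, 0 < δ →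
      ∀ᵐ p ∂(volume.restrict (cylinder Ω T ∩ {p | p.2 ≤ T - δ})), (v - w) p ≤ 0 := by
    intro δ hδ
    set A := cylinder Ω T ∩ {p | p.2 ≤ T - δ} with hA
    have hAQ : A ⊆ cylinder Ω T := inter_subset_left
    have hAm : MeasurableSet A := hQ.inter (measurableSet_le measurable_snd measurable_const)
    have hzA : IntegrableOn (v - w) A := hzI.mono_set hAQ
    have hfinA : IsFiniteMeasure (volume.restrict A) :=
      ⟨by rw [Measure.restrict_apply_univ]
          exact (measure_mono hAQ).trans_lt (hΩb.prod (Metric.isBounded_Ioo 0 T)).measure_lt_top⟩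
    have hle : ∀ k : ℝ, 0 < k → ∫ p in A, max ((v - w) p) 0 ≤ (B + (volume A).toReal) / k := by
      intro k hk
      have hiΘ : IntegrableOn (fun p => smoothPositivePart k ((v - w) p)) A :=
        Integrable.mono hzA ((continuous_smoothPositivePart k).comp_aestronglyMeasurable hzA.1)
          (Eventually.of_forall fun p => abs_smoothPositivePart_le k _)
      calc ∫ p in A, max ((v - w) p) 0
          ≤ ∫ p in A, (smoothPositivePart k ((v - w) p) + k⁻¹) := by
            refine integral_mono hzA.pos_part (hiΘ.add (integrable_const _)) fun p => ?_
            refine max_le ?_ (add_nonneg (smoothPositivePart_nonneg hk.le _) (inv_nonneg.2 hk.le))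
            linarith [sub_inv_le_smoothPositivePart hk ((v - w) p)]
        _ = (∫ p in A, smoothPositivePart k ((v - w) p)) + (volume A).toReal / k := by
            rw [integral_add hiΘ (integrable_const _)]
            simp [Measure.real, div_eq_mul_inv]
        _ ≤ B / k + (volume A).toReal / k := by
            gcongr
            refine le_trans (le_of_eq ?_) (hB k hk δ hδ)
            refine setIntegral_congr_fun hAm fun p hp => ?_
            simp only [indicator_of_mem (hAQ hp)]
        _ = (B + (volume A).toReal) / k := by ring
    have hlim : Tendsto (fun k : ℝ => (B + (volume A).toReal) / k) atTop (𝓝 0) :=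
      tendsto_const_nhds.div_atTop tendsto_id
    have h0 : ∫ p in A, max ((v - w) p) 0 ≤ 0 :=
      ge_of_tendsto hlim ((eventually_gt_atTop 0).mono hle)
    have h1 := (integral_eq_zero_iff_of_nonneg (fun p => le_max_right _ _) hzA.pos_part).1
      (le_antisymm h0 (integral_nonneg fun p => le_max_right _ _))
    filter_upwards [h1] with p hp
    exact max_eq_right_iff.1 hp
  -- The slabs with `δ = 1/(n+1)` exhaust the cylinder.
  have hall : ∀ᵐ p : Sp N × ℝ, ∀ n : ℕ,
      p ∈ cylinder Ω T ∩ {p | p.2 ≤ T - 1 / ((n : ℝ) + 1)} → (v - w) p ≤ 0 :=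
    ae_all_iff.2 fun n => (ae_restrict_iff' (hQ.inter
      (measurableSet_le measurable_snd measurable_const))).1 (hslab _ (by positivity))
  rw [ae_restrict_iff' hQ]
  filter_upwards [hall] with p hp hpQ
  obtain ⟨n, hn⟩ := exists_nat_one_div_lt (sub_pos.2 hpQ.2.2)
  have h3 := hp n ⟨hpQ, by
    show p.2 ≤ _
    linarith⟩
  exact sub_nonpos.1 h3

end Comparison

/-! ### Lipschitz bounds for `h` -/

section Lipschitz

theorem exists_lipschitz_on_ball {h : ℝ → ℝ} (hh : LocallyLipschitz h) (K : ℝ) :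
    ∃ L : ℝ≥0, LipschitzOnWith L h (Metric.closedBall 0 K) :=
  (hh.locallyLipschitzOn (s := Metric.closedBall 0 K)).exists_lipschitzOnWith_of_compact
    (isCompact_closedBall 0 K)

/-- A locally Lipschitz function is absolutely continuous on the segment between `a` and `b`, so its
increment is the integral of its derivative, and there `|l| ≤ max |a| |b|`. -/
theorem abs_sub_le_of_abs_deriv_le_rpow {h : ℝ → ℝ} (hh : LocallyLipschitz h) {θ c : ℝ}
    (hθ : 0 < θ) (hc : ∀ᵐ l : ℝ, |deriv h l| ≤ c * (|l| ^ θ + 1)) (a b : ℝ) :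
    |h a - h b| ≤ |c| * (|a| ^ θ + |b| ^ θ + 1) * |a - b| := by
  obtain ⟨L, hL⟩ := exists_lipschitz_on_ball hh (max |a| |b|)
  have hsub : uIcc b a ⊆ Metric.closedBall 0 (max |a| |b|) :=
    (convex_closedBall (0 : ℝ) _).ordConnected.uIcc_subset (by simp) (by simp)
  have hac := (hL.mono hsub).absolutelyContinuousOnInterval
  rw [← hac.integral_deriv_eq_sub]
  change ‖∫ x in b..a, deriv h x‖ ≤ _
  refine intervalIntegral.norm_integral_le_of_norm_le_const_ae ?_
  filter_upwards [hc] with l hl hlm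
  rw [Real.norm_eq_abs]
  have hlm' := hsub (uIoc_subset_uIcc hlm)
  rw [mem_closedBall_zero_iff, Real.norm_eq_abs] at hlm'
  have hp : |l| ^ θ ≤ |a| ^ θ + |b| ^ θ := by
    rcases le_max_iff.1 hlm' with h1 | h1
    · have := Real.rpow_le_rpow (abs_nonneg _) h1 hθ.le
      have := Real.rpow_nonneg (abs_nonneg b) θ
      linarith
    · have := Real.rpow_le_rpow (abs_nonneg _) h1 hθ.le
      have := Real.rpow_nonneg (abs_nonneg a) θ
      linarith
  refine hl.trans ?_
  have := Real.rpow_nonneg (abs_nonneg l) θ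
  calc c * (|l| ^ θ + 1) ≤ |c| * (|l| ^ θ + 1) := by gcongr; exact le_abs_self c
    _ ≤ _ := by gcongr

end Lipschitz

/-! ### The square-integrable weight in the two cases -/

section Weights

variable {X V : Type*} [MeasurableSpace X] {μ : Measure X} [NormedAddCommGroup V] {h : ℝ → ℝ}
  {E : X → V} {v w : X → ℝ}

theorem MemLp.exists_ae_abs_le (hv : MemLp v ⊤ μ) : ∃ K, ∀ᵐ p ∂μ, |v p| ≤ K := by
  refine ⟨(eLpNorm v ⊤ μ).toReal, ?_⟩
  rw [eLpNorm_exponent_top]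
  filter_upwards [ae_le_eLpNormEssSup (f := v) (μ := μ)] with p hp
  have hlt : eLpNormEssSup v μ ≠ ⊤ := by
    rw [← eLpNorm_exponent_top]
    exact hv.2.ne
  have := ENNReal.toReal_mono hlt hp
  rwa [toReal_enorm] at this

/-- Almost all values of `v` and `w` lie in one compact interval, on which `h` has a Lipschitz
constant `L`; take `ρ = L |E|`. -/
theorem exists_lipschitz_weight_of_bounded (hh : LocallyLipschitz h) (hE : MemLp E 2 μ)
    (hv : MemLp v ⊤ μ) (hw : MemLp w ⊤ μ) :
    ∃ ρ, MemLp ρ 2 μ ∧ ∀ᵐ p ∂μ, |h (v p) - h (w p)| * ‖E p‖ ≤ ρ p * |v p - w p| := by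
  obtain ⟨K, hK⟩ := MemLp.exists_ae_abs_le hv
  obtain ⟨K', hK'⟩ := MemLp.exists_ae_abs_le hw
  obtain ⟨L, hL⟩ := exists_lipschitz_on_ball hh (max K K')
  refine ⟨fun p => L * ‖E p‖, hE.norm.const_mul _, ?_⟩
  filter_upwards [hK, hK'] with p hp hp'
  have := hL.dist_le_mul (v p)
    (mem_closedBall_zero_iff.2 (hp.trans (le_max_left _ _))) (w p)
    (mem_closedBall_zero_iff.2 (hp'.trans (le_max_right _ _)))
  rw [Real.dist_eq, Real.dist_eq] at this
  calc |h (v p) - h (w p)| * ‖E p‖ ≤ (L * |v p - w p|) * ‖E p‖ := by gcongr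
    _ = L * ‖E p‖ * |v p - w p| := by ring

/-- The weight is `|c| (|v|^θ + |w|^θ + 1) |E|`. Its square is controlled by the assumed integrable
function plus `|E|²`. -/
theorem exists_lipschitz_weight_of_growth (hh : LocallyLipschitz h) {θ c : ℝ} (hθ : 0 < θ)
    (hc : ∀ᵐ l : ℝ, |deriv h l| ≤ c * (|l| ^ θ + 1)) (hE : MemLp E 2 μ)
    (hv : AEStronglyMeasurable v μ) (hw : AEStronglyMeasurable w μ)
    (hi : Integrable (fun p => (|v p| ^ (2 * θ) + |w p| ^ (2 * θ)) * ‖E p‖ ^ 2) μ) :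
    ∃ ρ, MemLp ρ 2 μ ∧ ∀ᵐ p ∂μ, |h (v p) - h (w p)| * ‖E p‖ ≤ ρ p * |v p - w p| := by
  have hpow : Continuous fun s : ℝ => |s| ^ θ :=
    continuous_abs.rpow_const fun _ => Or.inr hθ.le
  have hm : AEStronglyMeasurable (fun p => |c| * (|v p| ^ θ + |w p| ^ θ + 1) * ‖E p‖) μ :=
    ((((hpow.comp_aestronglyMeasurable hv).add (hpow.comp_aestronglyMeasurable hw)).add
      aestronglyMeasurable_const).const_mul _).mul hE.1.norm
  refine ⟨_, (memLp_two_iff_integrable_sq hm).2 ?_, Eventually.of_forall fun p => ?_⟩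
  · refine Integrable.mono' ((hi.add hE.norm.integrable_sq).const_mul (3 * c ^ 2)) (hm.pow 2)
      (Eventually.of_forall fun p => ?_)
    have hsq : ∀ s : ℝ, |s| ^ (2 * θ) = (|s| ^ θ) ^ 2 := fun s => by
      rw [mul_comm, Real.rpow_mul (abs_nonneg s), Real.rpow_two]
    simp only [Pi.add_apply, hsq]
    rw [Real.norm_eq_abs, abs_of_nonneg (sq_nonneg _), mul_pow, mul_pow, sq_abs]
    set x := |v p| ^ θ
    set y := |w p| ^ θ
    have hxy : (x + y + 1) ^ 2 ≤ 3 * (x ^ 2 + y ^ 2 + 1) := by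
      nlinarith [sq_nonneg (x - y), sq_nonneg (x - 1), sq_nonneg (y - 1)]
    calc c ^ 2 * (x + y + 1) ^ 2 * ‖E p‖ ^ 2 ≤ c ^ 2 * (3 * (x ^ 2 + y ^ 2 + 1)) * ‖E p‖ ^ 2 := by
          gcongr
      _ = _ := by ring
  · have := mul_le_mul_of_nonneg_right
      (abs_sub_le_of_abs_deriv_le_rpow hh hθ hc (v p) (w p)) (norm_nonneg (E p))
    refine this.trans (le_of_eq ?_)
    ring

end Weights

end ParabolicComparison

end

open ParabolicComparison in
theorem lemma2p3 {N : ℕ} (Ω : Set (Sp N)) (hΩ : IsOpen Ω) (hΩb : Bornology.IsBounded Ω)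
    (T : ℝ) (hT : 0 < T) (α β : ℝ) (hα : 0 < α) (hβ : 0 < β)
    (M : Sp N × ℝ → Matrix (Fin N) (Fin N) ℝ) (hM : IsElliptic Ω T α β M)
    (h : ℝ → ℝ) (hh : IsSuperlinear h)
    (E : Sp N × ℝ → Sp N) (hE : MemLp E 2 (volume.restrict (cylinder Ω T)))
    (f : ℝ → Wm12 Ω) (hf : MemL2Wm12 Ω T f)
    (v w : Sp N × ℝ → ℝ)
    (hv : IsSubsolution Ω T M h E f v) (hw : IsSupersolution Ω T M h E f w) :
    ((MemLp v ∞ (volume.restrict (cylinder Ω T)) ∧ MemLp w ∞ (volume.restrict (cylinder Ω T))) →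
      ∀ᵐ p ∂(volume.restrict (cylinder Ω T)), v p ≤ w p) ∧
    (∀ θ c : ℝ, 0 < θ →
      (∀ᵐ l : ℝ, |deriv h l| ≤ c * (|l| ^ θ + 1)) →
      IntegrableOn (fun p => (|v p| ^ (2 * θ) + |w p| ^ (2 * θ)) * ‖E p‖ ^ 2) (cylinder Ω T) →
      ∀ᵐ p ∂(volume.restrict (cylinder Ω T)), v p ≤ w p) := by
  constructor
  · rintro ⟨hvb, hwb⟩
    obtain ⟨ρ, hρ, hlip⟩ := exists_lipschitz_weight_of_bounded hh.1 hE hvb hwb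
    exact ae_le_of_subsolution_of_supersolution hΩ hΩb hT hα hM hv hw hρ hlip
  · intro θ c hθ hc hi
    have hvm : MemLp v 2 (volume.restrict (cylinder Ω T)) := by
      obtain ⟨Dv, G, g, v₀, hcand, -⟩ := hv
      exact hcand.mem.1
    have hwm : MemLp w 2 (volume.restrict (cylinder Ω T)) := by
      obtain ⟨Dw, G, g, w₀, hcand, -⟩ := hw
      exact hcand.mem.1
    obtain ⟨ρ, hρ, hlip⟩ := exists_lipschitz_weight_of_growth hh.1 hθ hc hE hvm.1 hwm.1 hi
    exact ae_le_of_subsolution_of_supersolution hΩ hΩb hT hα hM hv hw hρ hlip
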